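/- Let $K$ be a field of characteristic $0$ with a ring endomorphism $\sigma\colon K\to K$, and let $K\{Y\}=K[\,y_c^{(q)} : 1\le c\le n,\ q\ge 0\,]$ be the ring of difference polynomials in $Y=\{y_1,\dots,y_n\}$, with the endomorphism extending $\sigma$ such that $\sigma(y_c^{(q)})=y_c^{(q+1)}$; write $a^{(l)}=\sigma^l(a)$. A *difference ideal* of a ring with an endomorphism $\sigma$ is an ideal $I$ with $\sigma(I)\subseteq I$; it is *reflexive* if $\sigma(a)\in I$ implies $a\in I$, and *$\sigma$-prime* if it is reflexive and prime. Let $F=\{f_1,\dots,f_r\}\subset K\{Y\}$ and let $e$ be the maximal $q$ such that some $y_c^{(q)}$ occurs in some $f_j$; assume $e\ge 1$. Let $\mathfrak p$ be a $\sigma$-prime ideal of $K\{Y\}$ that is minimal among the $\sigma$-prime ideals containing the difference ideal $[F]$ generated by $F$, and let $\kappa$ be the residue class field of $\mathfrak p$. For $N\ge 0$ let $A_N$ be the polynomial ring over $K$ in the variables $y_c^{(q)}$ with $q\le N$, and let $B_N$ be the localization of $A_N$ at $A_N\cap\mathfrak p$. For $m\ge 0$ let $\Delta_m$ be the ideal of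 $B_{m-1+e}$ generated by the $f_j^{(l)}$, $1\le j\le r$, $0\le l\le m-1$ (so $\Delta_0=(0)$), and let $\Delta$ be the difference ideal generated by $F$ in $K\{Y\}_{\mathfrak p}$. Assume that $F$ is *quasi-regular at $\mathfrak p$*: for every $k\ge 1$ the Jacobian matrix of the polynomials $f_j^{(l)}$ ($1\le j\le r$, $0\le l\le k-1$) with respect to all variables of $A_{k-1+e}$ has full row rank over the domain $A_{k-1+e}/(A_{k-1+e}\cap\mathfrak p)$, and $\Delta$ is reflexive. For $k\ge 0$ and $i\ge e-1$ let $J_{k,i}$ be the $kr\times kn$ matrix of the partial derivatives of the $f_j^{(i-e+a)}$ ($1\le j\le r$, $1\le a\le k$) with respect to the $y_c^{(i+b)}$ ($1\le c\le n$, $1\le b\le k$), and let $\mu_{k,i}=\dim_\kappa\ker(J_{k,i}^{\tau})=kr-\operatorname{rank}_\kappa(J_{k,i})$, so $\mu_{0,i}=0$. Assume moreover that for all $k\ge 0$ and $i\ge e-1$ the rank of $J_{k,i}$ over the residue class field $\operatorname{Frac}(B_{m-1+e}/\Delta_m)$ of $\Delta_m$, with $m=i-e+1+k+s$, does not depend on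 $s\in\mathbb N$. Then there is exactly one $\omega\in\mathbb N$, called the $\mathfrak p$-difference index of $F$, such that for every $i\ge e-1$ one has $\mu_{k,i}<\mu_{k+1,i}$ for all $k<\omega$ and $\mu_{k,i}=\mu_{k+1,i}$ for all $k\ge\omega$. For this $\omega$ and for every $i\ge e-1$, $$\Delta_{i-e+1+\omega}\cap B_i=\Delta\cap B_i$$ in the ring $B_i$, and moreover $$\omega=\min\{h\in\mathbb N : \Delta_{i-e+1+h}\cap B_i=\Delta\cap B_i\}.$$ -/

import Mathlib

noncomputable section

namespace DifferenceAlgebra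

/-! ### Difference ideals

A difference ring is a commutative ring `R` with a ring endomorphism `φ : R →+* R`. -/

section DifferenceIdeals

variable {R : Type*} [CommRing R]

/-- `I` is a difference ideal: it is stable under the endomorphism. -/
def IsDiffIdeal (φ : R →+* R) (I : Ideal R) : Prop :=
  ∀ a ∈ I, φ a ∈ I

/-- `I` is reflexive: `φ a ∈ I` implies `a ∈ I`. -/
def IsReflexive (φ : R →+* R) (I : Ideal R) : Prop :=
  ∀ a, φ a ∈ I → a ∈ I

/-- A difference prime ideal: a reflexive difference ideal that is a prime ideal. -/
structure IsDiffPrime (φ : R →+* R) (I : Ideal R) : Prop where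
  isDiffIdeal : IsDiffIdeal φ I
  isReflexive : IsReflexive φ I
  isPrime : I.IsPrime

/-- The difference ideal `[S]` generated by `S`: the smallest difference ideal containing `S`. -/
def diffSpan (φ : R →+* R) (S : Set R) : Ideal R :=
  sInf {I : Ideal R | IsDiffIdeal φ I ∧ S ⊆ I}

theorem IsDiffPrime.eq_comap {φ : R →+* R} {I : Ideal R} (h : IsDiffPrime φ I) :
    I = I.comap φ :=
  le_antisymm (fun a ha => h.isDiffIdeal a ha) (fun a ha => h.isReflexive a ha)

/-- `p` is a difference prime ideal containing `[S]`, and minimal among those. -/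
def IsMinimalDiffPrimeOver (φ : R →+* R) (S : Set R) (p : Ideal R) : Prop :=
  Minimal (fun q : Ideal R => IsDiffPrime φ q ∧ diffSpan φ S ≤ q) p

end DifferenceIdeals

/-! ### Difference polynomials -/

section DifferencePolynomials

variable {K : Type*} [Field K] {n r : ℕ}

/-- The ring `K{y_1, …, y_n}` of difference polynomials; the variable `X (c, q)` is the
`q`-th transform of the difference indeterminate `y_c`. -/
abbrev DiffPoly (K : Type*) [Field K] (n : ℕ) : Type _ := MvPolynomial (Fin n × ℕ) K

/-- The endomorphism of `K{y_1, …, y_n}` extending `σ : K →+* K`: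
it applies `σ` to the coefficients and raises the order of each variable by one. -/
def transform (σ : K →+* K) : DiffPoly K n →+* DiffPoly K n :=
  (MvPolynomial.rename fun v : Fin n × ℕ => (v.1, v.2 + 1)).toRingHom.comp (MvPolynomial.map σ)

/-- The number `e`, the maximal order of a variable occurring in the system `f`
(zero if no variable occurs). -/
def maxOrder (f : Fin r → DiffPoly K n) : ℕ :=
  Finset.univ.sup fun j => (f j).vars.sup Prod.snd

/-- The polynomial ring `A_N` in the variables of order at most `N`. -/
abbrev A (K : Type*) [Field K] (n N : ℕ) : Type _ :=
  MvPolynomial {v : Fin n × ℕ // v.2 ≤ N} K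

/-- The inclusion of `A_N` in `K{y_1, …, y_n}`. -/
def valA (K : Type*) [Field K] (n N : ℕ) : A K n N →+* DiffPoly K n :=
  (MvPolynomial.rename (Subtype.val : {v : Fin n × ℕ // v.2 ≤ N} → Fin n × ℕ)).toRingHom

/-- The inclusion `A_N → A_{N'}` for `N ≤ N'`. -/
def inclA (K : Type*) [Field K] (n : ℕ) {N N' : ℕ} (h : N ≤ N') : A K n N →+* A K n N' :=
  (MvPolynomial.rename fun v : {v : Fin n × ℕ // v.2 ≤ N} =>
    (⟨v.1, v.2.trans h⟩ : {v : Fin n × ℕ // v.2 ≤ N'})).toRingHom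

theorem valA_comp_inclA {N N' : ℕ} (h : N ≤ N') :
    (valA K n N').comp (inclA K n h) = valA K n N := by
  ext a
  · simp [valA, inclA]
  · simp [valA, inclA]

/-- A difference polynomial of order at most `N`, as an element of `A_N`
(the variables of order greater than `N` are sent to zero; see `valA_toA`). -/
def toA (N : ℕ) : DiffPoly K n →+* A K n N :=
  (MvPolynomial.killCompl
    (Subtype.val_injective (p := fun v : Fin n × ℕ => v.2 ≤ N))).toRingHom

theorem valA_toA {N : ℕ} {a : DiffPoly K n} (ha : ∀ v ∈ a.vars, v.2 ≤ N) :
    valA K n N (toA N a) = a := by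
  obtain ⟨b, rfl⟩ := MvPolynomial.exists_rename_eq_of_vars_subset_range a
    (Subtype.val : {v : Fin n × ℕ // v.2 ≤ N} → Fin n × ℕ) Subtype.val_injective
    (fun v hv => ⟨⟨v, ha v hv⟩, rfl⟩)
  simp [valA, toA, MvPolynomial.killCompl_rename_app]

theorem order_iterate_transform_le (σ : K →+* K) (f : Fin r → DiffPoly K n) (j : Fin r) (l : ℕ) :
    ∀ v ∈ ((transform σ)^[l] (f j)).vars, v.2 ≤ maxOrder f + l := by
  classical
  induction l with
  | zero =>
    intro v hv
    have h1 : v.2 ≤ (f j).vars.sup Prod.snd := Finset.le_sup (f := Prod.snd) hv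
    exact h1.trans (Finset.le_sup (f := fun j => (f j).vars.sup Prod.snd) (Finset.mem_univ j))
  | succ l ih =>
    intro v hv
    rw [Function.iterate_succ_apply'] at hv
    have h1 := MvPolynomial.vars_rename (fun v : Fin n × ℕ => (v.1, v.2 + 1))
      (MvPolynomial.map σ ((transform σ)^[l] (f j))) hv
    obtain ⟨w, hw, rfl⟩ := Finset.mem_image.1 h1
    have h2 := ih w (MvPolynomial.vars_map _ _ hw)
    simp only
    omega

/-- The transform `f_j^{(l)}`, `l < m`, as an element of `A_{m-1+e}`. -/
def transformIn (σ : K →+* K) (f : Fin r → DiffPoly K n) (m l : ℕ) (j : Fin r) :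
    A K n (m + maxOrder f - 1) :=
  toA (m + maxOrder f - 1) ((transform σ)^[l] (f j))

theorem valA_transformIn (σ : K →+* K) (f : Fin r → DiffPoly K n) {m l : ℕ} (h : l < m)
    (j : Fin r) :
    valA K n (m + maxOrder f - 1) (transformIn σ f m l j) = (transform σ)^[l] (f j) :=
  valA_toA fun v hv => (order_iterate_transform_le σ f j l v hv).trans (by omega)

theorem vars_pderiv_subset {ι : Type*} (v : ι) (a : MvPolynomial ι K) :
    (MvPolynomial.pderiv v a).vars ⊆ a.vars := by
  classical
  have key : ∀ b ∈ MvPolynomial.supported K (a.vars : Set ι),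
      MvPolynomial.pderiv v b ∈ MvPolynomial.supported K (a.vars : Set ι) := by
    intro b hb
    induction hb using Algebra.adjoin_induction with
    | mem x hx =>
      obtain ⟨w, hw, rfl⟩ := hx
      rw [MvPolynomial.pderiv_X]
      by_cases h : v = w
      · subst h; simp [one_mem]
      · rw [Pi.single_eq_of_ne (Ne.symm h)]; exact zero_mem _
    | algebraMap c => rw [Derivation.map_algebraMap]; exact zero_mem _
    | add x y _ _ hx hy => rw [map_add]; exact add_mem hx hy
    | mul x y hx' hy' hx hy =>
      rw [Derivation.leibniz, smul_eq_mul, smul_eq_mul]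
      exact add_mem (mul_mem hx' hy) (mul_mem hy' hx)
  have h := MvPolynomial.mem_supported.1 (key a (MvPolynomial.mem_supported_vars a))
  exact_mod_cast h

/-! ### Localizations, and the ideals of the system -/

/-- The prime ideal `A_N ∩ p` of `A_N`. -/
def pTrunc (p : Ideal (DiffPoly K n)) (N : ℕ) : Ideal (A K n N) :=
  p.comap (valA K n N)

instance (p : Ideal (DiffPoly K n)) [p.IsPrime] (N : ℕ) : (pTrunc p N).IsPrime :=
  Ideal.comap_isPrime (valA K n N) p

theorem pTrunc_eq_comap (p : Ideal (DiffPoly K n)) {N N' : ℕ} (h : N ≤ N') :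
    pTrunc p N = (pTrunc p N').comap (inclA K n h) := by
  rw [pTrunc, pTrunc, Ideal.comap_comap, valA_comp_inclA]

/-- The local ring `B_N`, the localization of `A_N` at `A_N ∩ p`. -/
abbrev B (p : Ideal (DiffPoly K n)) [p.IsPrime] (N : ℕ) : Type _ :=
  Localization.AtPrime (pTrunc p N)

/-- The inclusion `B_N → B_{N'}` for `N ≤ N'`. -/
def inclB (p : Ideal (DiffPoly K n)) [p.IsPrime] {N N' : ℕ} (h : N ≤ N') : B p N →+* B p N' :=
  Localization.localRingHom (pTrunc p N) (pTrunc p N')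
    (inclA K n h) (pTrunc_eq_comap p h)

/-- The inclusion of `B_N` in the localization of `K{y_1, …, y_n}` at `p`. -/
def inclLoc (p : Ideal (DiffPoly K n)) [p.IsPrime] (N : ℕ) :
    B p N →+* Localization.AtPrime p :=
  Localization.localRingHom (pTrunc p N) p (valA K n N) rfl

/-- The endomorphism of the localization of `K{y_1, …, y_n}` at a difference prime ideal `p`. -/
def transformLoc (σ : K →+* K) (p : Ideal (DiffPoly K n)) [p.IsPrime]
    (hp : IsDiffPrime (transform σ) p) : Localization.AtPrime p →+* Localization.AtPrime p :=
  Localization.localRingHom p p (transform σ) hp.eq_comap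

/-- The difference ideal `Δ` generated by the system in the localization of
`K{y_1, …, y_n}` at `p`. -/
def Delta (σ : K →+* K) (f : Fin r → DiffPoly K n) (p : Ideal (DiffPoly K n)) [p.IsPrime]
    (hp : IsDiffPrime (transform σ) p) : Ideal (Localization.AtPrime p) :=
  diffSpan (transformLoc σ p hp)
    (Set.range fun j => algebraMap (DiffPoly K n) (Localization.AtPrime p) (f j))

/-- The ideal `Δ_m` generated by the `f_j^{(l)}`, `l < m`, in the local ring `B_{m-1+e}`
(so `Δ_0 = 0`). -/
def DeltaTrunc (σ : K →+* K) (f : Fin r → DiffPoly K n) (p : Ideal (DiffPoly K n)) [p.IsPrime]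
    (m : ℕ) : Ideal (B p (m + maxOrder f - 1)) :=
  Ideal.span (Set.range fun x : Fin m × Fin r =>
    algebraMap (A K n (m + maxOrder f - 1)) (B p (m + maxOrder f - 1))
      (transformIn σ f m x.1 x.2))

/-- The system `f` is quasi-regular at `p`: for every `k ≥ 1` the Jacobian matrix of the
`f_j^{(l)}`, `l ≤ k - 1`, with respect to the variables of order at most `k - 1 + e` has
linearly independent rows over the domain `A_{k-1+e} / (A_{k-1+e} ∩ p)`, and `Δ` is reflexive. -/
structure IsQuasiRegular (σ : K →+* K) (f : Fin r → DiffPoly K n) (p : Ideal (DiffPoly K n))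
    [p.IsPrime] (hp : IsDiffPrime (transform σ) p) : Prop where
  jacobian : ∀ k : ℕ, 1 ≤ k →
    LinearIndependent (A K n (k + maxOrder f - 1) ⧸ pTrunc p (k + maxOrder f - 1))
      (fun (x : Fin k × Fin r) (v : {v : Fin n × ℕ // v.2 ≤ k + maxOrder f - 1}) =>
        Ideal.Quotient.mk (pTrunc p (k + maxOrder f - 1))
          (MvPolynomial.pderiv v (transformIn σ f k x.1 x.2)))
  reflexive : IsReflexive (transformLoc σ p hp) (Delta σ f p hp)

/-! ### The pseudo-Jacobian matrices and the difference index -/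

/-- The matrix `J_{k,i}`, for `i ≥ e - 1`: its rows are indexed by the
`f_j^{(i-e+1+a)}`, `0 ≤ a < k`, its columns by the `y_c^{(i+1+b)}`, `0 ≤ b < k`. -/
def pseudoJacobian (σ : K →+* K) (f : Fin r → DiffPoly K n) (k i : ℕ) :
    Matrix (Fin k × Fin r) (Fin k × Fin n) (DiffPoly K n) :=
  Matrix.of fun x y =>
    MvPolynomial.pderiv (y.2, i + 1 + (y.1 : ℕ))
      ((transform σ)^[i + 1 - maxOrder f + (x.1 : ℕ)] (f x.2))

/-- The number `μ_{k,i}`, the dimension of the kernel of the transpose of `J_{k,i}` over the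
residue class field of `p`. -/
def mu (σ : K →+* K) (f : Fin r → DiffPoly K n) (p : Ideal (DiffPoly K n)) [p.IsPrime]
    (k i : ℕ) : ℕ :=
  Module.finrank p.ResidueField
    (LinearMap.ker
      (((pseudoJacobian σ f k i).map (algebraMap (DiffPoly K n) p.ResidueField)).transpose
        ).mulVecLin)

/-- The matrix `J_{k,i}` with its entries viewed in `A_{m-1+e}`, where `m = i - e + 1 + k + s`. -/
def pseudoJacobianIn (σ : K →+* K) (f : Fin r → DiffPoly K n) (k i s : ℕ) :
    Matrix (Fin k × Fin r) (Fin k × Fin n)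
      (A K n (i + 1 - maxOrder f + k + s + maxOrder f - 1)) :=
  (pseudoJacobian σ f k i).map (toA (i + 1 - maxOrder f + k + s + maxOrder f - 1))

theorem map_valA_pseudoJacobianIn (σ : K →+* K) (f : Fin r → DiffPoly K n) (k i s : ℕ) :
    (pseudoJacobianIn σ f k i s).map (valA K n _) = pseudoJacobian σ f k i := by
  ext1 x y
  refine valA_toA fun v hv => ?_
  have h1 := x.1.isLt
  have h2 := order_iterate_transform_le σ f x.2 (i + 1 - maxOrder f + (x.1 : ℕ)) v
    (vars_pderiv_subset _ _ hv)
  omega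

/-- The residue class field of a prime ideal `I` of `R`, as the field of fractions of `R ⧸ I`
(for an ideal that is not prime this is the total ring of fractions). -/
abbrev FracQuot {R : Type*} [CommRing R] (I : Ideal R) : Type _ :=
  FractionRing (R ⧸ I)

/-- The canonical map from `R` to the residue class field of `I`. -/
def toFracQuot {R : Type*} [CommRing R] (I : Ideal R) : R →+* FracQuot I :=
  (algebraMap (R ⧸ I) (FractionRing (R ⧸ I))).comp (Ideal.Quotient.mk I)

/-- The rank of `J_{k,i}` over the residue class field of `Δ_m`, `m = i - e + 1 + k + s`. -/
def rankOverDelta (σ : K →+* K) (f : Fin r → DiffPoly K n) (p : Ideal (DiffPoly K n))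
    [p.IsPrime] (k i s : ℕ) : ℕ :=
  ((pseudoJacobianIn σ f k i s).map fun a =>
    toFracQuot (DeltaTrunc σ f p (i + 1 - maxOrder f + k + s)) (algebraMap _ (B p _) a)).rank

/-- For all `k` and all `i ≥ e - 1`, the rank of `J_{k,i}` over the residue class field of
`Δ_{i-e+1+k+s}` does not depend on `s`. -/
def HasConstantRanks (σ : K →+* K) (f : Fin r → DiffPoly K n) (p : Ideal (DiffPoly K n))
    [p.IsPrime] : Prop :=
  ∀ k i : ℕ, maxOrder f - 1 ≤ i → ∀ s : ℕ, rankOverDelta σ f p k i s = rankOverDelta σ f p k i 0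

/-- `ω` is the `p`-difference index of the system: the sequence `k ↦ μ_{k,i}` (the same one for
all `i ≥ e - 1`) is strictly increasing up to `ω` and constant from `ω` on. -/
def IsDifferenceIndex (σ : K →+* K) (f : Fin r → DiffPoly K n) (p : Ideal (DiffPoly K n))
    [p.IsPrime] (ω : ℕ) : Prop :=
  ∀ i : ℕ, maxOrder f - 1 ≤ i →
    (∀ k < ω, mu σ f p k i < mu σ f p (k + 1) i) ∧
    (∀ k, ω ≤ k → mu σ f p k i = mu σ f p (k + 1) i)

/-- The ideal `Δ_{i-e+1+h} ∩ B_i` of `B_i`, for `i ≥ e - 1`. -/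
def DeltaTruncInter (σ : K →+* K) (f : Fin r → DiffPoly K n) (p : Ideal (DiffPoly K n))
    [p.IsPrime] (i h : ℕ) : Ideal (B p i) :=
  (DeltaTrunc σ f p (i + 1 - maxOrder f + h)).comap
    (inclB p (show i ≤ i + 1 - maxOrder f + h + maxOrder f - 1 by omega))

/-- The ideal `Δ ∩ B_i` of `B_i`. -/
def DeltaInter (σ : K →+* K) (f : Fin r → DiffPoly K n) (p : Ideal (DiffPoly K n))
    [p.IsPrime] (hp : IsDiffPrime (transform σ) p) (i : ℕ) : Ideal (B p i) :=
  (Delta σ f p hp).comap (inclLoc p i)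

end DifferencePolynomials

end DifferenceAlgebra

end

open DifferenceAlgebra

/-! Fix `i` and let P_k be the contraction of Δ_{i-e+1+k} to the polynomial ring A_i. By the
Jacobian condition, the generators of Δ_m are part of a regular system of parameters of the regular
local ring B_{m-1+e}, so Δ_m and P_k are prime. Membership in Δ can be tested in Δ_m for large `m`,
so Δ is prime too. Since Δ is reflexive, its contraction to K{Y} is a σ-prime ideal inside `p`
containing [F], hence equal to `p` by minimality (`algebraMap_mem_Delta_iff`). As A_i is noetherian,
P_k = p ∩ A_i for large `k`.

The theorem then reduces to a height formula, ht P_k = (i-e+1)r + μ_{k,i} (`height_DeltaTruncPoly`),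
because nested primes of equal finite height coincide. In characteristic zero the height of the
ideal of a point is the dimension of its conormal space, the span of the gradients of the
polynomials vanishing there (`height_ker_eq_finrank_conormal`). At the generic point of Δ_m the
gradients of the f_j^{(l)} form a basis. The conormal space of the projection to the coordinates of
order at most `i` consists of the conormal vectors supported on these coordinates; this rests on
extending derivations (`comp_mem_conormal_rename`). Its dimension is therefore that of the left
kernel of the Jacobian block in the variables of order greater than `i`, a block that is J_{k,i} up
to zero rows. The constant rank hypothesis replaces the residue field of Δ_m by that of `p`.

The index exists because k ↦ μ_{k,i} is nondecreasing, concave, independent of `i`, and bounded by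
the height of p ∩ A_{e-1}. -/

open IsLocalRing

/-! ### Regular local rings: quotients by part of a regular system of parameters, and integrality.
-/

/-- A quotient of a regular local ring by elements that are linearly independent in the cotangent
space is regular. -/
theorem IsRegularLocalRing.quotient_span_range_and_finrank_le {R : Type*} [CommRing R] [IsRegularLocalRing R]
    {ι : Type*} [Finite ι] (x : ι → maximalIdeal R)
    (hx : LinearIndependent (ResidueField R) (fun i => (maximalIdeal R).toCotangent (x i))) :
    ∃ _ : IsRegularLocalRing (R ⧸ Ideal.span (Set.range fun i => (x i : R))),
      Module.finrank (ResidueField (R ⧸ Ideal.span (Set.range fun i => (x i : R))))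
        (CotangentSpace (R ⧸ Ideal.span (Set.range fun i => (x i : R)))) + Nat.card ι ≤
      Module.finrank (ResidueField R) (CotangentSpace R) := by
  classical
  have := Fintype.ofFinite ι
  set I : Ideal R := Ideal.span (Set.range fun i => (x i : R)) with hI
  have hIm : I ≤ maximalIdeal R := by
    rw [hI, Ideal.span_le]
    rintro _ ⟨i, rfl⟩
    exact (x i).2
  have hnt : Nontrivial (R ⧸ I) :=
    Ideal.Quotient.nontrivial_iff.2 (ne_top_of_le_ne_top Ideal.IsPrime.ne_top' hIm)
  have hloc : IsLocalRing (R ⧸ I) := .of_surjective' _ Ideal.Quotient.mk_surjective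
  -- The classes of the `x i` are completed to a basis by classes of elements `y k`. By Nakayama the
  -- `x i` and `y k` generate the maximal ideal, so the `y k` generate it modulo `I`.
  let b := Module.Basis.sumExtend hx
  have hfin := Module.Finite.finite_basis b
  have : Finite (Module.Basis.sumExtendIndex hx) := Finite.sum_right ι
  have := Fintype.ofFinite (Module.Basis.sumExtendIndex hx)
  choose y hy using fun k => (maximalIdeal R).toCotangent_surjective (b (Sum.inr k))
  have hd : Module.finrank (ResidueField R) (CotangentSpace R) =
      Fintype.card ι + Fintype.card (Module.Basis.sumExtendIndex hx) := by
    rw [Module.finrank_eq_card_basis b, Fintype.card_sum]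
  have htop : Submodule.span R (Set.range (Sum.elim x y)) = ⊤ := by
    rw [← CotangentSpace.span_image_eq_top_iff, eq_top_iff, ← b.span_eq, Submodule.span_le]
    rintro _ ⟨i | k, rfl⟩
    · refine Submodule.subset_span ⟨x i, ⟨Sum.inl i, rfl⟩, ?_⟩
      simp only [b, Module.Basis.sumExtend, Module.Basis.reindex_apply, Module.Basis.extend_apply_self]
      rfl
    · exact Submodule.subset_span ⟨y k, ⟨Sum.inr k, rfl⟩, hy k⟩
  have hspan : maximalIdeal R = Ideal.span (Set.range fun k => ((Sum.elim x y) k : R)) := by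
    have := congrArg (Submodule.map (maximalIdeal R).subtype) htop
    rw [Submodule.map_span, Submodule.map_top, Submodule.range_subtype, ← Set.range_comp] at this
    exact this.symm
  have hmax : maximalIdeal (R ⧸ I) =
      Ideal.span (Set.range fun k => Ideal.Quotient.mk I (y k : R)) := by
    have h1 : maximalIdeal (R ⧸ I) = (maximalIdeal R).map (Ideal.Quotient.mk I) := by
      have hmaxl : ((maximalIdeal R).map (Ideal.Quotient.mk I)).IsMaximal := by
        apply Ideal.IsMaximal.map_of_surjective_of_ker_le Ideal.Quotient.mk_surjective
        rwa [Ideal.mk_ker]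
      exact (IsLocalRing.eq_maximalIdeal hmaxl).symm
    rw [h1, congrArg (Ideal.map (Ideal.Quotient.mk I)) hspan, Ideal.map_span]
    apply le_antisymm
    · rw [Ideal.span_le]
      rintro _ ⟨_, ⟨i | k, rfl⟩, rfl⟩
      · have : Ideal.Quotient.mk I (x i : R) = 0 :=
          Ideal.Quotient.eq_zero_iff_mem.2 (Ideal.subset_span ⟨i, rfl⟩)
        simp [this]
      · exact Ideal.subset_span ⟨k, rfl⟩
    · rw [Ideal.span_le]
      rintro _ ⟨k, rfl⟩
      exact Ideal.subset_span ⟨_, ⟨Sum.inr k, rfl⟩, rfl⟩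
  have hupper : (maximalIdeal (R ⧸ I)).spanFinrank ≤
      Fintype.card (Module.Basis.sumExtendIndex hx) := by
    rw [hmax]
    refine (Submodule.spanFinrank_span_le_ncard_of_finite (Set.finite_range _)).trans ?_
    rw [← Nat.card_eq_fintype_card, ← Nat.card_coe_set_eq]
    exact Finite.card_range_le _
  -- Dividing by `ι` many elements of the maximal ideal lowers the dimension by at most that number.
  -- So the dimension of the quotient is at least the number of the `y k`, which generate its
  -- maximal ideal; this is regularity.
  have hdim := ringKrullDim_le_ringKrullDim_quotient_add_encard
    (Set.range fun i => (x i : R)) (by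
      rintro _ ⟨i, rfl⟩
      rw [IsLocalRing.ringJacobson_eq_maximalIdeal]
      exact (x i).2)
  rw [← hI, ← (IsRegularLocalRing.iff_finrank_cotangentSpace R).1 inferInstance, hd] at hdim
  have hcard : (Set.range fun i => (x i : R)).encard ≤ Fintype.card ι := by
    rw [← Set.image_univ]
    refine (Set.encard_image_le _ _).trans ?_
    simp
  refine ⟨?_, by
    rw [← IsLocalRing.spanFinrank_maximalIdeal_eq_finrank_cotangentSpace, hd,
      Nat.card_eq_fintype_card]
    omega⟩
  apply IsRegularLocalRing.of_spanFinrank_maximalIdeal_le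
  have hdim' : ((Fintype.card ι + Fintype.card (Module.Basis.sumExtendIndex hx) : ℕ) :
      WithBot ℕ∞) ≤ ringKrullDim (R ⧸ I) + (Fintype.card ι : ℕ) := by
    refine hdim.trans ?_
    gcongr
    exact_mod_cast hcard
  refine le_trans (by exact_mod_cast hupper)
    (show ((Fintype.card (Module.Basis.sumExtendIndex hx) : ℕ) : WithBot ℕ∞) ≤ _ from ?_)
  obtain ⟨N, hN⟩ : ∃ N : ℕ, ringKrullDim (R ⧸ I) = N := by
    have h1 : ringKrullDim (R ⧸ I) < ⊤ := ringKrullDim_lt_top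
    have h2 : ringKrullDim (R ⧸ I) ≠ ⊥ := ringKrullDim_ne_bot
    obtain ⟨a, ha⟩ := WithBot.ne_bot_iff_exists.1 h2
    rw [← ha] at h1 ⊢
    obtain ⟨N, hN⟩ := ENat.ne_top_iff_exists.1 (WithBot.coe_lt_coe.1 h1).ne
    exact ⟨N, by rw [← hN]; rfl⟩
  rw [hN] at hdim' ⊢
  have : Fintype.card ι + Fintype.card (Module.Basis.sumExtendIndex hx) ≤
    N + Fintype.card ι := by exact_mod_cast hdim'
  exact_mod_cast (by omega)

/-- Induction on the embedding dimension. Some `x` in the maximal ideal avoids its square and all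
minimal primes; the quotient by `x` is regular of smaller embedding dimension, so `x` generates a
prime ideal. A minimal prime `q` below it omits `x`, so each element of `q` is `x` times an element
of `q`, and Nakayama gives `q = ⊥`. -/
theorem IsRegularLocalRing.isDomain_of_finrank_le (d : ℕ) :
    ∀ (R : Type*) [CommRing R] [IsRegularLocalRing R],
      Module.finrank (ResidueField R) (CotangentSpace R) ≤ d → IsDomain R := by
  induction d with
  | zero =>
    intro R _ _ h
    exact (IsLocalRing.finrank_cotangentSpace_eq_zero_iff.1 (Nat.le_zero.1 h)).isDomain
  | succ d ih =>
    intro R _ _ hle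
    rcases hle.lt_or_eq with hlt | h
    · exact ih R (Nat.lt_succ_iff.1 hlt)
    have hfin : (minimalPrimes R).Finite := minimalPrimes.finite_of_isNoetherianRing R
    have hdim : (maximalIdeal R).height = (d + 1 : ℕ) := by
      have h1 := (IsRegularLocalRing.iff_finrank_cotangentSpace R).1 inferInstance
      rw [h, ← IsLocalRing.maximalIdeal_height_eq_ringKrullDim] at h1
      exact_mod_cast h1.symm
    have hnot : ∀ q ∈ minimalPrimes R, ¬ maximalIdeal R ≤ q := by
      intro q hq hle
      have := hq.1.1
      have hqm : q = maximalIdeal R := le_antisymm (IsLocalRing.le_maximalIdeal this.ne_top) hle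
      have h0 : q.height = 0 := by
        rw [Ideal.height_eq_zero_iff]; exact hq
      rw [hqm, hdim] at h0
      exact absurd h0 (by simp)
    have hsq : ¬ maximalIdeal R ≤ maximalIdeal R ^ 2 := by
      intro hle
      have : maximalIdeal R = ⊥ := by
        apply Submodule.eq_bot_of_le_smul_of_le_jacobson_bot (maximalIdeal R) _
          (IsNoetherian.noetherian _)
        · rwa [smul_eq_mul, ← pow_two]
        · exact IsLocalRing.maximalIdeal_le_jacobson _
      rw [this, Ideal.height_bot] at hdim
      exact absurd hdim.symm (by simp)
    obtain ⟨x, hxm, hxs, hxq⟩ : ∃ x ∈ maximalIdeal R, x ∉ maximalIdeal R ^ 2 ∧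
        ∀ q ∈ minimalPrimes R, x ∉ q := by
      by_contra! hcon
      -- Prime avoidance tolerates exceptional ideals that are not prime; both exceptional slots are
      -- filled with the square of the maximal ideal.
      have := (Ideal.subset_union_prime (s := insert (maximalIdeal R ^ 2) hfin.toFinset)
        (f := id) (I := maximalIdeal R) (maximalIdeal R ^ 2) (maximalIdeal R ^ 2) (by
          intro q hq hq' _
          simp only [Finset.mem_insert, Set.Finite.mem_toFinset] at hq
          exact (hq.resolve_left hq').1.1)).1 (by
          intro x hx
          simp only [Finset.coe_insert, Set.Finite.coe_toFinset, Set.biUnion_insert, id]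
          by_cases hxs : x ∈ maximalIdeal R ^ 2
          · exact Or.inl hxs
          · obtain ⟨q, hq, hxq⟩ := hcon x hx hxs
            exact Or.inr (Set.mem_biUnion hq hxq))
      obtain ⟨q, hq, hle⟩ := this
      simp only [Finset.mem_insert, Set.Finite.mem_toFinset] at hq
      rcases hq with rfl | hq
      · exact hsq hle
      · exact hnot q hq hle
    have hli : LinearIndependent (ResidueField R)
        (fun i : Unit => (maximalIdeal R).toCotangent ((fun _ => ⟨x, hxm⟩) i)) := by
      have hne : (maximalIdeal R).toCotangent ⟨x, hxm⟩ ≠ 0 := fun h0 =>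
        hxs ((Ideal.toCotangent_eq_zero _ _).1 h0)
      rw [Fintype.linearIndependent_iff]
      intro g hg i
      by_contra hgi
      simp only [Finset.univ_unique, Finset.sum_singleton] at hg
      have h1 := congrArg (fun v : CotangentSpace R => (g i)⁻¹ • v) hg
      simp only [smul_zero] at h1
      rw [Subsingleton.elim (default : Unit) i, smul_smul, inv_mul_cancel₀ hgi, one_smul] at h1
      exact hne h1
    obtain ⟨hreg, hrk⟩ := IsRegularLocalRing.quotient_span_range_and_finrank_le _ hli
    have hprime : (Ideal.span (Set.range fun _ : Unit => x)).IsPrime := by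
      rw [← Ideal.Quotient.isDomain_iff_prime]
      refine ih _ ?_
      rw [h, Nat.card_unique] at hrk
      exact Nat.le_of_succ_le_succ hrk
    rw [Set.range_const] at hprime
    obtain ⟨q, hq, hqx⟩ := Ideal.exists_minimalPrimes_le (bot_le : ⊥ ≤ Ideal.span {x})
    have hqp : q.IsPrime := hq.1.1
    have hq0 : q = ⊥ := by
      apply Submodule.eq_bot_of_le_smul_of_le_jacobson_bot (maximalIdeal R) _
        (IsNoetherian.noetherian _) _ (IsLocalRing.maximalIdeal_le_jacobson _)
      intro y hy
      obtain ⟨a, rfl⟩ := Ideal.mem_span_singleton.1 (hqx hy)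
      exact Submodule.smul_mem_smul hxm ((hqp.mem_or_mem hy).resolve_left (hxq q hq))
    rw [hq0] at hqp
    exact (IsDomain.of_bot_isPrime R)

instance (priority := low) IsRegularLocalRing.isDomain (R : Type*) [CommRing R]
    [IsRegularLocalRing R] : IsDomain R :=
  IsRegularLocalRing.isDomain_of_finrank_le _ R le_rfl

theorem IsRegularLocalRing.isPrime_span_range {R : Type*} [CommRing R] [IsRegularLocalRing R]
    {ι : Type*} [Finite ι] (x : ι → maximalIdeal R)
    (hx : LinearIndependent (ResidueField R) (fun i => (maximalIdeal R).toCotangent (x i))) :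
    (Ideal.span (Set.range fun i => (x i : R))).IsPrime := by
  obtain ⟨_, -⟩ := IsRegularLocalRing.quotient_span_range_and_finrank_le x hx
  exact (Ideal.Quotient.isDomain_iff_prime _).1 inferInstance

/-! ### Extension of derivations in characteristic zero. -/

open TensorProduct

/-- Derivations extend along formally smooth field extensions. -/
theorem Derivation.exists_extension_of_formallySmooth {K S L : Type*} [CommRing K] [CommRing S]
    [Field L] [Algebra K S] [Algebra K L] [Algebra S L] [IsScalarTower K S L]
    [Algebra.FormallySmooth S L] (D : Derivation K S L) :
    ∃ D' : Derivation K L L, ∀ s, D' (algebraMap S L s) = D s := by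
  -- The kernel is the image of the first cotangent homology of `L` over `S`, which vanishes by
  -- formal smoothness. Over the field `L` the injection splits, and the splitting extends `D`.
  have hinj : Function.Injective (KaehlerDifferential.mapBaseChange K S L) := by
    rw [← LinearMap.ker_eq_bot, Submodule.eq_bot_iff]
    intro x hx
    obtain ⟨y, rfl⟩ := (Algebra.H1Cotangent.exact_δ_mapBaseChange K S L x).1 hx
    rw [Subsingleton.elim y 0, map_zero]
  obtain ⟨g, hg⟩ := LinearMap.exists_leftInverse_of_injective _ (LinearMap.ker_eq_bot.2 hinj)
  let φ : Ω[L⁄K] →ₗ[L] L := (D.liftKaehlerDifferential.liftBaseChange L).comp g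
  refine ⟨φ.compDer (KaehlerDifferential.D K L), fun s => ?_⟩
  have h1 := LinearMap.congr_fun hg (1 ⊗ₜ KaehlerDifferential.D K S s)
  simp only [LinearMap.comp_apply, KaehlerDifferential.mapBaseChange_tmul,
    KaehlerDifferential.map_D, one_smul, LinearMap.id_apply] at h1
  simp [φ, h1]

/-- The extension is algebraic over a purely transcendental one, and algebraic extensions are
separable in characteristic zero. -/
theorem Algebra.FormallySmooth.of_field_of_charZero (F L : Type*) [Field F] [Field L] [CharZero F]
    [Algebra F L] : Algebra.FormallySmooth F L := by
  obtain ⟨s, x, hs⟩ := exists_isTranscendenceBasis' F L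
  have := hs.isAlgebraic_field
  exact .of_algebraicIndependent_of_isSeparable hs.1

/-- A field of characteristic zero is formally smooth over its subrings. -/
theorem Algebra.FormallySmooth.of_faithfulSMul_of_charZero (S L : Type*) [CommRing S] [Field L]
    [CharZero L] [Algebra S L] [FaithfulSMul S L] : Algebra.FormallySmooth S L := by
  have : IsDomain S := .of_faithfulSMul S L
  let : Algebra (FractionRing S) L := FractionRing.liftAlgebra S L
  have : CharZero (FractionRing S) :=
    (RingHom.charZero_iff (algebraMap (FractionRing S) L).injective).2 inferInstance
  have : Algebra.FormallySmooth S (FractionRing S) := .of_isLocalization (nonZeroDivisors S)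
  have := Algebra.FormallySmooth.of_field_of_charZero (FractionRing S) L
  exact .comp S (FractionRing S) L

/-! ### Gradients and conormal spaces of points. -/

namespace MvPolynomial

variable {K ι L : Type*} [Field K] [Field L] [Algebra K L]

/-- The gradient of a polynomial, with entries mapped to a field. -/
noncomputable def grad (φ : MvPolynomial ι K →ₐ[K] L) (g : MvPolynomial ι K) : ι → L :=
  fun v => φ (pderiv v g)

theorem grad_add (φ : MvPolynomial ι K →ₐ[K] L) (g h : MvPolynomial ι K) :
    grad φ (g + h) = grad φ g + grad φ h := by
  ext; simp [grad]

theorem grad_mul (φ : MvPolynomial ι K →ₐ[K] L) (g h : MvPolynomial ι K) :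
    grad φ (g * h) = φ g • grad φ h + φ h • grad φ g := by
  ext; simp [grad]

/-- The span of the gradients of the elements of the kernel of `φ`. -/
noncomputable def conormal (φ : MvPolynomial ι K →ₐ[K] L) : Submodule L (ι → L) :=
  Submodule.span L (grad φ '' RingHom.ker φ)

/-- By the Leibniz rule, `grad φ` is linear over the polynomial ring on polynomials vanishing at the
point. The induction therefore carries the vanishing along. -/
theorem grad_mem_span {τ : Type*} (φ : MvPolynomial ι K →ₐ[K] L) {x : τ → MvPolynomial ι K}
    (hx : ∀ i, φ (x i) = 0) {h : MvPolynomial ι K} (hh : h ∈ Ideal.span (Set.range x)) :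
    grad φ h ∈ Submodule.span L (Set.range fun i => grad φ (x i)) := by
  suffices H : φ h = 0 ∧ grad φ h ∈ Submodule.span L (Set.range fun i => grad φ (x i)) from H.2
  induction hh using Submodule.span_induction with
  | mem _ h =>
    obtain ⟨i, rfl⟩ := h
    exact ⟨hx i, Submodule.subset_span ⟨i, rfl⟩⟩
  | zero => exact ⟨map_zero _, by
    rw [show grad φ (0 : MvPolynomial ι K) = 0 by ext; simp [grad]]
    exact zero_mem _⟩
  | add a b _ _ ha hb =>
    exact ⟨by rw [map_add, ha.1, hb.1, add_zero], by rw [grad_add]; exact add_mem ha.2 hb.2⟩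
  | smul a b _ hb =>
    refine ⟨by rw [smul_eq_mul, map_mul, hb.1, mul_zero], ?_⟩
    rw [smul_eq_mul, grad_mul, hb.1, zero_smul, add_zero]
    exact Submodule.smul_mem _ _ hb.2

/-- The form needed for ideals of a localization: at a zero of `g`, the gradient of `s * g` is `φ s`
times that of `g`. -/
theorem grad_mem_span_of_mul_mem {τ : Type*} (φ : MvPolynomial ι K →ₐ[K] L)
    {x : τ → MvPolynomial ι K} (hx : ∀ i, φ (x i) = 0) {g s : MvPolynomial ι K} (hs : φ s ≠ 0)
    (hg : φ g = 0) (hh : s * g ∈ Ideal.span (Set.range x)) :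
    grad φ g ∈ Submodule.span L (Set.range fun i => grad φ (x i)) := by
  have h := grad_mem_span φ hx hh
  rw [grad_mul, hg, zero_smul, add_zero] at h
  exact (Submodule.smul_mem_iff _ hs).1 h

/-- A functional vanishing on the conormal space of a point defines a derivation of the subring
generated by the coordinates of the point. -/
theorem exists_derivation_range (φ : MvPolynomial ι K →ₐ[K] L) (ℓ : (ι → L) →ₗ[L] L)
    (hℓ : ∀ u ∈ conormal φ, ℓ u = 0) :
    ∃ D : Derivation K φ.range L, ∀ g, D ⟨φ g, g, rfl⟩ = ℓ (grad φ g) := by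
  choose c hc using fun s : φ.range => s.2
  have key : ∀ g h, φ g = φ h → ℓ (grad φ g) = ℓ (grad φ h) := by
    intro g h hgh
    have h1 : ℓ (grad φ (g - h)) = 0 :=
      hℓ _ (Submodule.subset_span ⟨_, by simpa [sub_eq_zero] using hgh, rfl⟩)
    have h2 : grad φ g = grad φ (g - h) + grad φ h := by rw [← grad_add, sub_add_cancel]
    rw [h2, map_add, h1, zero_add]
  have hc' : ∀ s, φ (c s) = s := hc
  let T : φ.range →ₗ[K] L :=
    { toFun := fun s => ℓ (grad φ (c s))
      map_add' := fun s t => by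
        rw [← map_add, ← grad_add]
        exact key _ _ (by rw [map_add, hc', hc', hc']; rfl)
      map_smul' := fun a s => by
        have h1 : grad φ (a • c s) = algebraMap K L a • grad φ (c s) := by
          ext v
          simp only [grad, Derivation.map_smul, map_smul, Pi.smul_apply, algebraMap_smul]
        rw [RingHom.id_apply, ← algebraMap_smul L a (ℓ _), ← map_smul, ← h1]
        exact key _ _ (by rw [map_smul, hc', hc']; rfl) }
  refine ⟨Derivation.mk' T fun s t => ?_, fun g => key _ _ (hc' _)⟩
  change ℓ (grad φ (c (s * t))) = (s : L) * ℓ (grad φ (c t)) + (t : L) * ℓ (grad φ (c s))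
  rw [key (c (s * t)) (c s * c t) (by rw [map_mul, hc', hc', hc']; rfl), grad_mul, map_add,
    map_smul, map_smul, hc', hc', smul_eq_mul, smul_eq_mul]

/-- The chain rule; a derivation of `L` thus restricts to a functional that annihilates the conormal
space. -/
theorem derivation_apply_eq_sum [Fintype ι] (φ : MvPolynomial ι K →ₐ[K] L) (D : Derivation K L L)
    (g : MvPolynomial ι K) : D (φ g) = ∑ v, grad φ g v * D (φ (X v)) := by
  classical
  induction g using MvPolynomial.induction_on with
  | C a => simp [grad, ← MvPolynomial.algebraMap_eq]
  | add p q hp hq => rw [map_add, map_add, hp, hq, grad_add, ← Finset.sum_add_distrib]; simp [add_mul]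
  | mul_X p i hp =>
    rw [map_mul, Derivation.leibniz, hp, grad_mul]
    simp only [smul_eq_mul, Pi.add_apply, Pi.smul_apply, add_mul, Finset.sum_add_distrib,
      mul_assoc, ← Finset.mul_sum]
    congr 2
    rw [Finset.sum_eq_single i]
    · simp [grad]
    · intro b _ hb
      simp [grad, pderiv_X_of_ne hb.symm]
    · simp

/-- In characteristic zero, a conormal vector at a point which only involves some of the
coordinates is a conormal vector at the projection of the point to these coordinates. -/
theorem comp_mem_conormal_rename [CharZero L] {ι' : Type*} [Finite ι'] {j : ι → ι'}
    (hj : Function.Injective j) (φ : MvPolynomial ι' K →ₐ[K] L) {w : ι' → L}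
    (hw : w ∈ conormal φ) (hw0 : ∀ v ∉ Set.range j, w v = 0) :
    w ∘ j ∈ conormal (φ.comp (rename j)) := by
  classical
  have := Fintype.ofFinite ι'
  have := Finite.of_injective j hj
  have := Fintype.ofFinite ι
  -- A functional `ℓ` vanishing on the conormal space of the projected point but not at `w ∘ j` is a
  -- derivation of the ring generated by the projected coordinates. In characteristic zero it
  -- extends to a derivation `D'` of `L`. The chain rule makes `D'` annihilate every conormal vector
  -- of the full point, in particular `w`; as `w` is supported on the range of `j`, this says `ℓ (w
  -- ∘ j) = 0`.
  by_contra hcon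
  obtain ⟨ℓ, hℓ, hle⟩ := Submodule.exists_le_ker_of_notMem hcon
  obtain ⟨D, hD⟩ := exists_derivation_range (φ.comp (rename j)) ℓ (fun u hu => hle hu)
  have := Algebra.FormallySmooth.of_faithfulSMul_of_charZero (φ.comp (rename j)).range L
  obtain ⟨D', hD'⟩ := D.exists_extension_of_formallySmooth
  have h0 : ∀ u ∈ conormal φ, ∑ v, u v * D' (φ (X v)) = 0 := by
    intro u hu
    induction hu using Submodule.span_induction with
    | mem _ h =>
      obtain ⟨g, hg, rfl⟩ := h
      rw [← derivation_apply_eq_sum, (RingHom.mem_ker).1 hg, map_zero]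
    | zero => simp
    | add a b _ _ ha hb => simp [add_mul, Finset.sum_add_distrib, ha, hb]
    | smul a b _ hb => simp [mul_assoc, ← Finset.mul_sum, hb]
  apply hℓ
  have hX : ∀ i, D' (φ (X (j i))) = ℓ (Pi.single i 1) := by
    intro i
    have h1 := hD (X i)
    rw [← hD'] at h1
    have h2 : grad (φ.comp (rename j)) (X i) = Pi.single i 1 := by
      ext v
      rw [grad, pderiv_X]
      rcases eq_or_ne v i with rfl | hne
      · simp
      · simp [Pi.single_eq_of_ne hne, Pi.single_eq_of_ne hne.symm]
    rw [h2] at h1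
    rw [← h1]
    simp
  have h3 : ℓ (w ∘ j) = ∑ i, w (j i) * D' (φ (X (j i))) := by
    simp only [hX]
    conv_lhs => rw [← LinearMap.sum_single_apply (fun _ => L) (w ∘ j)]
    rw [map_sum]
    refine Finset.sum_congr rfl fun i _ => ?_
    rw [Function.comp_apply, ← smul_eq_mul, ← map_smul, ← Pi.single_smul, smul_eq_mul, mul_one]
  rw [h3, ← h0 w hw, ← Finset.sum_image (f := fun v => w v * D' (φ (X v))) (s := Finset.univ) (g := j)
    (fun a _ b _ h => hj h)]
  refine Finset.sum_subset (Finset.subset_univ _) fun v _ hv => ?_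
  rw [hw0 v (fun ⟨i, hi⟩ => hv (Finset.mem_image.2 ⟨i, Finset.mem_univ _, hi⟩)), zero_mul]

end MvPolynomial

/-! ### Cotangent spaces of localized polynomial rings and the Jacobian criterion. -/

/-- A generating set of the maximal ideal of a noetherian local ring contains a system of generators
that is a basis of the cotangent space. -/
theorem IsLocalRing.exists_linearIndependent_toCotangent {B : Type*} [CommRing B] [IsLocalRing B]
    [IsNoetherianRing B] {S : Set B} (hS : Ideal.span S = maximalIdeal B) :
    ∃ (d : ℕ) (x : Fin d → maximalIdeal B),
      Module.finrank (ResidueField B) (CotangentSpace B) = d ∧ (∀ i, (x i : B) ∈ S) ∧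
      LinearIndependent (ResidueField B) (fun i => (maximalIdeal B).toCotangent (x i)) ∧
      Ideal.span (Set.range fun i => (x i : B)) = maximalIdeal B := by
  have hSm : ∀ a ∈ S, a ∈ maximalIdeal B := fun a ha => hS ▸ Ideal.subset_span ha
  let c : S → maximalIdeal B := fun a => ⟨a, hSm a a.2⟩
  have hc : Submodule.span B (Set.range c) = ⊤ := by
    apply Submodule.map_injective_of_injective (maximalIdeal B).injective_subtype
    rw [Submodule.map_span, Submodule.map_top, Submodule.range_subtype, ← Set.range_comp]
    refine Eq.trans ?_ hS
    congr 1
    ext y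
    simp [c]
  rw [← CotangentSpace.span_image_eq_top_iff] at hc
  obtain ⟨b, hbs, hbspan, hbli⟩ := exists_linearIndependent (ResidueField B)
    ((maximalIdeal B).toCotangent '' Set.range c : Set (CotangentSpace B))
  have hbtop : ⊤ ≤ Submodule.span (ResidueField B) (Set.range ((↑) : b → CotangentSpace B)) := by
    rw [Subtype.range_coe, hbspan]
    exact hc.ge
  let bas := Module.Basis.mk hbli hbtop
  have : Finite b := Module.Finite.finite_basis bas
  let e : b ≃ Fin (Module.finrank (ResidueField B) (CotangentSpace B)) :=
    (Finite.equivFin b).trans (finCongr (Module.finrank_eq_nat_card_basis bas).symm)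
  have hex : ∀ y : b, ∃ a : S, (maximalIdeal B).toCotangent (c a) = (y : CotangentSpace B) := by
    intro y
    obtain ⟨_, ⟨a, rfl⟩, ha⟩ := hbs y.2
    exact ⟨a, ha⟩
  choose a ha using hex
  refine ⟨_, fun i => c (a (e.symm i)), rfl, fun i => (a (e.symm i)).2, ?_, ?_⟩
  · have : (fun i => (maximalIdeal B).toCotangent (c (a (e.symm i)))) =
        (fun y : b => (y : CotangentSpace B)) ∘ e.symm := by
      ext1 i
      exact ha _
    rw [this]
    exact hbli.comp _ e.symm.injective
  · have h1 : Submodule.span B (Set.range fun i => c (a (e.symm i))) = ⊤ := by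
      rw [← CotangentSpace.span_image_eq_top_iff, ← Set.range_comp, eq_top_iff]
      refine hbtop.trans (Submodule.span_mono ?_)
      rintro _ ⟨y, rfl⟩
      exact ⟨e y, by simp [ha]⟩
    have h2 := congrArg (Submodule.map (maximalIdeal B).subtype) h1
    rw [Submodule.map_span, Submodule.map_top, Submodule.range_subtype, ← Set.range_comp] at h2
    exact h2

/-- `P` is the kernel of `φ`, so `R ⧸ P` embeds in `L`, and linear independence survives passage
from a domain to a field containing it. -/
theorem LinearIndependent.quotient_lift {R L ι τ : Type*} [CommRing R] [Field L] [Finite ι]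
    {P : Ideal R} {φ : R →+* L} (h1 : ∀ a ∈ P, φ a = 0) (h2 : ∀ a, φ a = 0 → a ∈ P)
    {x : τ → ι → R} (hli : LinearIndependent (R ⧸ P) (fun i v => Ideal.Quotient.mk P (x i v))) :
    LinearIndependent L (fun i v => φ (x i v)) := by
  let F : R ⧸ P →+* L := Ideal.Quotient.lift P φ h1
  have hF : Function.Injective F := by
    rw [injective_iff_map_eq_zero]
    intro a ha
    obtain ⟨a, rfl⟩ := Ideal.Quotient.mk_surjective a
    exact Ideal.Quotient.eq_zero_iff_mem.2 (h2 a ha)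
  algebraize [F]
  have : FaithfulSMul (R ⧸ P) L := (faithfulSMul_iff_algebraMap_injective _ _).2 hF
  have h3 := (linearIndependent_algebraMap_comp_iff (S := L)).2 hli
  exact h3

namespace MvPolynomial

/-- Let `γ : C → κ` be surjective with kernel of square zero and `κ` formally smooth. If a
polynomial and its partial derivatives vanish at a point over `κ`, then the polynomial vanishes
at every point over `C` above it. -/
theorem eq_zero_of_pderiv_eq_zero {K ι C κ : Type*} [CommRing K] [Finite ι] [CommRing C]
    [CommRing κ] [Algebra K C] [Algebra K κ] [Algebra.FormallySmooth K κ] (γ : C →ₐ[K] κ)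
    (hγ : Function.Surjective γ) (hmul : ∀ a b, γ a = 0 → γ b = 0 → a * b = 0)
    (Q : MvPolynomial ι K →ₐ[K] C) {g : MvPolynomial ι K} (hg : γ (Q g) = 0)
    (hd : ∀ v, γ (Q (pderiv v g)) = 0) : Q g = 0 := by
  classical
  have := Fintype.ofFinite ι
  have hnil : IsNilpotent (RingHom.ker (γ : C →+* κ)) := by
    refine ⟨2, ?_⟩
    rw [pow_two, Ideal.zero_eq_bot, eq_bot_iff, Ideal.mul_le]
    exact fun a ha b hb => (Submodule.mem_bot _).2 (hmul a b ha hb)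
  -- Formal smoothness gives a section of `γ`, that is, a coefficient field in `C`. The identity
  -- `key` is the first order Taylor formula at the point with coordinates in this field; it is
  -- exact because the kernel of `γ` has square zero.
  let s : κ →ₐ[K] C := Algebra.FormallySmooth.liftOfSurjective (AlgHom.id K κ) γ hγ hnil
  have hs : ∀ c, γ (s c) = c := fun c =>
    Algebra.FormallySmooth.liftOfSurjective_apply (AlgHom.id K κ) γ hγ hnil c
  have key : ∀ h, Q h - s (γ (Q h)) =
      ∑ v, s (γ (Q (pderiv v h))) * (Q (X v) - s (γ (Q (X v)))) := by
    intro h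
    induction h using MvPolynomial.induction_on with
    | C a => simp [← MvPolynomial.algebraMap_eq]
    | add p q hp hq =>
      simp only [map_add, add_mul, Finset.sum_add_distrib, ← hp, ← hq]
      ring
    | mul_X p i hp =>
      have h0 : (Q p - s (γ (Q p))) * (Q (X i) - s (γ (Q (X i)))) = 0 :=
        hmul _ _ (by simp [hs]) (by simp [hs])
      have h1 : ∑ v, s (γ (Q (pderiv v (p * X i)))) * (Q (X v) - s (γ (Q (X v)))) =
          s (γ (Q p)) * (Q (X i) - s (γ (Q (X i)))) + s (γ (Q (X i))) * (Q p - s (γ (Q p))) := by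
        rw [hp, Finset.mul_sum]
        simp only [Derivation.leibniz, smul_eq_mul, map_add, map_mul, add_mul,
          Finset.sum_add_distrib, mul_assoc]
        congr 1
        rw [Finset.sum_eq_single i]
        · simp
        · intro b _ hb
          simp [pderiv_X_of_ne hb.symm]
        · simp
      rw [h1, map_mul, map_mul, map_mul]
      linear_combination h0
  have := key g
  rw [hg, map_zero, sub_zero] at this
  rw [this]
  exact Finset.sum_eq_zero fun v _ => by rw [hd v, map_zero, zero_mul]

/-- The preceding vanishing statement applied to the quotient of `B` by the square of its maximal
ideal. -/
theorem mem_maximalIdeal_sq_of_pderiv_mem {K ι B : Type*} [CommRing K] [Finite ι] [CommRing B]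
    [IsLocalRing B] [Algebra K B] [Algebra.FormallySmooth K (ResidueField B)]
    (Q : MvPolynomial ι K →ₐ[K] B) {g : MvPolynomial ι K} (hg : Q g ∈ maximalIdeal B)
    (hd : ∀ v, Q (pderiv v g) ∈ maximalIdeal B) : Q g ∈ maximalIdeal B ^ 2 := by
  let γ : (B ⧸ maximalIdeal B ^ 2) →ₐ[K] ResidueField B :=
    Ideal.Quotient.liftₐ _ (IsScalarTower.toAlgHom K B (ResidueField B)) fun b hb =>
      (residue_eq_zero_iff b).2 (Ideal.pow_le_self two_ne_zero hb)
  have hγq : ∀ b : B, γ (Ideal.Quotient.mk _ b) = residue B b := fun b => rfl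
  have hγ : Function.Surjective γ := fun c => by
    obtain ⟨b, rfl⟩ := residue_surjective c
    exact ⟨Ideal.Quotient.mk _ b, rfl⟩
  have hmul : ∀ a b, γ a = 0 → γ b = 0 → a * b = 0 := by
    intro a b ha hb
    obtain ⟨a, rfl⟩ := Ideal.Quotient.mk_surjective a
    obtain ⟨b, rfl⟩ := Ideal.Quotient.mk_surjective b
    rw [hγq, residue_eq_zero_iff] at ha hb
    rw [← map_mul, Ideal.Quotient.eq_zero_iff_mem]
    exact (pow_two (maximalIdeal B)).symm ▸ Ideal.mul_mem_mul ha hb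
  exact Ideal.Quotient.eq_zero_iff_mem.1 (eq_zero_of_pderiv_eq_zero γ hγ hmul
    ((Ideal.Quotient.mkₐ K _).comp Q) ((residue_eq_zero_iff _).2 hg)
    (fun v => (residue_eq_zero_iff _).2 (hd v)))

/-- The first order Taylor expansion at a point, in the direction of a variable. -/
noncomputable def dualNumberHom {K ι F : Type*} [CommRing K] [CommRing F]
    (π : MvPolynomial ι K →+* F) (v : ι) : MvPolynomial ι K →+* TrivSqZeroExt F F where
  toFun g := TrivSqZeroExt.inl (π g) + TrivSqZeroExt.inr (π (pderiv v g))
  map_one' := by ext <;> simp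
  map_zero' := by ext <;> simp
  map_add' g h := by ext <;> simp
  map_mul' g h := by ext <;> simp [Derivation.leibniz, mul_comm]

theorem dualNumberHom_fst {K ι F : Type*} [CommRing K] [CommRing F]
    (π : MvPolynomial ι K →+* F) (v : ι) (g : MvPolynomial ι K) :
    (dualNumberHom π v g).fst = π g := by simp [dualNumberHom]

theorem dualNumberHom_snd {K ι F : Type*} [CommRing K] [CommRing F]
    (π : MvPolynomial ι K →+* F) (v : ι) (g : MvPolynomial ι K) :
    (dualNumberHom π v g).snd = π (pderiv v g) := by simp [dualNumberHom]

section Localization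

variable {K ι : Type*} [Field K] (P : Ideal (MvPolynomial ι K)) [P.IsPrime]

theorem algebraMap_mem_maximalIdeal {g : MvPolynomial ι K} (hg : g ∈ P) :
    algebraMap _ (Localization.AtPrime P) g ∈ maximalIdeal (Localization.AtPrime P) :=
  (IsLocalization.AtPrime.to_map_mem_maximal_iff _ P g).2 hg

theorem residue_algebraMap_eq_zero_iff {g : MvPolynomial ι K} :
    residue (Localization.AtPrime P) (algebraMap _ _ g) = 0 ↔ g ∈ P := by
  rw [residue_eq_zero_iff, IsLocalization.AtPrime.to_map_mem_maximal_iff _ P g]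

/-- The first order Taylor expansion, in the direction of a variable, at a prime ideal. -/
theorem exists_dualNumber_hom (v : ι) :
    ∃ ψ : Localization.AtPrime P →+* TrivSqZeroExt (ResidueField (Localization.AtPrime P))
        (ResidueField (Localization.AtPrime P)),
      (∀ b, (ψ b).fst = residue _ b) ∧
      ∀ g : MvPolynomial ι K, (ψ (algebraMap _ _ g)).snd =
        residue (Localization.AtPrime P) (algebraMap _ _ (pderiv v g)) := by
  let π := (residue (Localization.AtPrime P)).comp
    (algebraMap (MvPolynomial ι K) (Localization.AtPrime P))
  let T := dualNumberHom π v
  have hT1 : ∀ g, (T g).fst = π g := dualNumberHom_fst π v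
  have hT2 : ∀ g, (T g).snd = π (pderiv v g) := dualNumberHom_snd π v
  have hu : ∀ s : P.primeCompl, IsUnit (T s) := by
    intro s
    rw [TrivSqZeroExt.isUnit_iff_isUnit_fst, hT1, isUnit_iff_ne_zero]
    exact fun h => s.2 ((residue_algebraMap_eq_zero_iff P).1 h)
  refine ⟨IsLocalization.lift hu, ?_, fun g => ?_⟩
  · let F := ResidueField (Localization.AtPrime P)
    have : (TrivSqZeroExt.fstHom F F F).toRingHom.comp (IsLocalization.lift hu) =
        residue (Localization.AtPrime P) := by
      apply IsLocalization.ringHom_ext P.primeCompl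
      refine RingHom.ext fun g => ?_
      change (IsLocalization.lift hu (algebraMap _ (Localization.AtPrime P) g)).fst = π g
      rw [IsLocalization.lift_eq, hT1]
    exact fun b => congrArg (fun F => F b) this
  · rw [IsLocalization.lift_eq]
    exact hT2 g

/-- Elements of a prime ideal of a polynomial ring whose gradients are linearly independent over
the residue field are linearly independent in the cotangent space. -/
theorem linearIndependent_toCotangent {τ : Type*} [Finite τ] {x : τ → MvPolynomial ι K}
    (hx : ∀ i, x i ∈ P)
    (hli : LinearIndependent (ResidueField (Localization.AtPrime P)) (fun i (v : ι) =>
      residue (Localization.AtPrime P) (algebraMap _ _ (pderiv v (x i))))) :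
    LinearIndependent (ResidueField (Localization.AtPrime P)) (fun i =>
      (maximalIdeal (Localization.AtPrime P)).toCotangent
        ⟨algebraMap _ _ (x i), algebraMap_mem_maximalIdeal P (hx i)⟩) := by
  have := Fintype.ofFinite τ
  rw [Fintype.linearIndependent_iff] at hli ⊢
  intro c hc
  apply hli
  choose b hb using fun i => residue_surjective (R := Localization.AtPrime P) (c i)
  have hmem : ∑ i, b i * algebraMap _ (Localization.AtPrime P) (x i) ∈
      maximalIdeal (Localization.AtPrime P) ^ 2 := by
    have h1 : (maximalIdeal (Localization.AtPrime P)).toCotangent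
        (∑ i, b i • ⟨algebraMap _ _ (x i), algebraMap_mem_maximalIdeal P (hx i)⟩) = 0 := by
      rw [map_sum, ← hc]
      refine Finset.sum_congr rfl fun i _ => ?_
      rw [map_smul, ← hb]
      rfl
    rw [Ideal.toCotangent_eq_zero] at h1
    simpa using h1
  ext v
  obtain ⟨ψ, hψ1, hψ2⟩ := exists_dualNumber_hom P v
  -- `ψ` sends the maximal ideal to elements with zero first component, and products of two such
  -- elements vanish. The second component of `ψ` then turns `hmem` into a relation between the
  -- partial derivatives with respect to `v`.
  have hker : maximalIdeal (Localization.AtPrime P) ^ 2 ≤ RingHom.ker ψ := by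
    rw [pow_two, Ideal.mul_le]
    intro a ha b hb
    have ha' : (ψ a).fst = 0 := by rw [hψ1, residue_eq_zero_iff]; exact ha
    have hb' : (ψ b).fst = 0 := by rw [hψ1, residue_eq_zero_iff]; exact hb
    rw [RingHom.mem_ker, map_mul]
    ext <;> simp [ha', hb']
  have h2 := hker hmem
  rw [RingHom.mem_ker, map_sum] at h2
  have h3 := congrArg TrivSqZeroExt.snd h2
  rw [TrivSqZeroExt.snd_sum] at h3
  rw [Finset.sum_apply]
  rw [TrivSqZeroExt.snd_zero] at h3
  rw [Pi.zero_apply, ← h3]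
  refine Finset.sum_congr rfl fun i _ => ?_
  have h4 : (ψ (algebraMap _ _ (x i))).fst = 0 := by
    rw [hψ1, residue_algebraMap_eq_zero_iff]; exact hx i
  rw [map_mul, TrivSqZeroExt.snd_mul, h4, hψ1, hψ2, hb]
  simp

theorem isPrime_span_of_linearIndependent [Finite ι] {τ : Type*} [Finite τ]
    {x : τ → MvPolynomial ι K} (hx : ∀ i, x i ∈ P)
    (hli : LinearIndependent (ResidueField (Localization.AtPrime P)) (fun i (v : ι) =>
      residue (Localization.AtPrime P) (algebraMap _ _ (pderiv v (x i))))) :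
    (Ideal.span (Set.range fun i => algebraMap _ (Localization.AtPrime P) (x i))).IsPrime :=
  IsRegularLocalRing.isPrime_span_range
    (fun i => ⟨algebraMap _ _ (x i), algebraMap_mem_maximalIdeal P (hx i)⟩)
    (linearIndependent_toCotangent P hx hli)

/-- In characteristic zero, an element of a prime ideal whose partial derivatives all belong to
the prime ideal belongs to the square of the maximal ideal of the localization. -/
theorem algebraMap_mem_maximalIdeal_sq [CharZero K] [Finite ι] {g : MvPolynomial ι K} (hg : g ∈ P)
    (hd : ∀ v, pderiv v g ∈ P) :
    algebraMap _ (Localization.AtPrime P) g ∈ maximalIdeal (Localization.AtPrime P) ^ 2 := by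
  have := Algebra.FormallySmooth.of_field_of_charZero K (ResidueField (Localization.AtPrime P))
  exact mem_maximalIdeal_sq_of_pderiv_mem
    (IsScalarTower.toAlgHom K (MvPolynomial ι K) (Localization.AtPrime P))
    (algebraMap_mem_maximalIdeal P hg) (fun v => algebraMap_mem_maximalIdeal P (hd v))

end Localization

/-- Elements of a prime ideal that are linearly independent in the cotangent space have linearly
independent gradients. -/
theorem linearIndependent_pderiv_of_toCotangent {K ι τ : Type*} [Field K] [CharZero K] [Finite ι]
    [Finite τ] (P : Ideal (MvPolynomial ι K)) [P.IsPrime] {x : τ → MvPolynomial ι K}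
    (hx : ∀ i, x i ∈ P)
    (hli : LinearIndependent (ResidueField (Localization.AtPrime P)) (fun i =>
      (maximalIdeal (Localization.AtPrime P)).toCotangent
        ⟨algebraMap _ _ (x i), algebraMap_mem_maximalIdeal P (hx i)⟩)) :
    LinearIndependent (MvPolynomial ι K ⧸ P)
      (fun i v => Ideal.Quotient.mk P (pderiv v (x i))) := by
  have := Fintype.ofFinite τ
  rw [Fintype.linearIndependent_iff] at hli ⊢
  intro a ha
  choose a' ha' using fun y => Ideal.Quotient.mk_surjective (a y)
  have hd : ∀ v, ∑ y, a' y * pderiv v (x y) ∈ P := by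
    intro v
    rw [← Ideal.Quotient.eq_zero_iff_mem, map_sum]
    have := congrFun ha v
    simpa [← ha'] using this
  -- By `hd` the partial derivatives of the combination of the `x y` lie in `P`, so in
  -- characteristic zero the combination lies in the square of the maximal ideal. This gives a
  -- relation in the cotangent space.
  have hsq := algebraMap_mem_maximalIdeal_sq P (g := ∑ y, a' y * x y)
    (Ideal.sum_mem _ fun y _ => Ideal.mul_mem_left _ _ (hx y)) (fun v => by
      rw [map_sum]
      simp only [Derivation.leibniz, smul_eq_mul, Finset.sum_add_distrib]
      exact add_mem (hd v) (Ideal.sum_mem _ fun y _ => Ideal.mul_mem_right _ _ (hx y)))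
  intro y
  have := hli (fun y => residue (Localization.AtPrime P) (algebraMap _ _ (a' y))) (by
    have h2 : (maximalIdeal (Localization.AtPrime P)).toCotangent
        (∑ y, algebraMap _ (Localization.AtPrime P) (a' y) •
        ⟨algebraMap _ _ (x y), algebraMap_mem_maximalIdeal P (hx y)⟩) = 0 := by
      rw [Ideal.toCotangent_eq_zero]
      simpa only [AddSubmonoidClass.coe_finsetSum, Submodule.coe_smul, smul_eq_mul,
        map_sum, map_mul] using hsq
    rw [map_sum] at h2
    rw [← h2]
    refine Finset.sum_congr rfl fun y _ => ?_
    rw [map_smul]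
    rfl) y
  rw [← ha', Ideal.Quotient.eq_zero_iff_mem]
  exact (residue_algebraMap_eq_zero_iff P).1 this

/-- The image of `P` generates the maximal ideal of the localization, so a minimal system of
generators can be taken from `P` itself. Its length is the height because the localization is
regular; clearing denominators gives the factor `s`. -/
theorem exists_basis_of_prime {K ι : Type*} [Field K] [Finite ι]
    (P : Ideal (MvPolynomial ι K)) [P.IsPrime] :
    ∃ (d : ℕ) (x : Fin d → MvPolynomial ι K) (hx : ∀ i, x i ∈ P), P.height = d ∧
      LinearIndependent (ResidueField (Localization.AtPrime P)) (fun i =>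
        (maximalIdeal (Localization.AtPrime P)).toCotangent
          ⟨algebraMap _ _ (x i), algebraMap_mem_maximalIdeal P (hx i)⟩) ∧
      ∀ g ∈ P, ∃ s ∉ P, s * g ∈ Ideal.span (Set.range x) := by
  obtain ⟨d, y, hd, hyS, hyli, hyspan⟩ := IsLocalRing.exists_linearIndependent_toCotangent
    (B := Localization.AtPrime P) (S := algebraMap (MvPolynomial ι K) _ '' P)
    Localization.AtPrime.map_eq_maximalIdeal
  choose x hx hxy using hyS
  have hy : y = fun i => ⟨algebraMap _ _ (x i), algebraMap_mem_maximalIdeal P (hx i)⟩ := by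
    ext i
    exact (hxy i).symm
  subst hy
  refine ⟨d, x, hx, ?_, hyli, fun g hg => ?_⟩
  · have h1 := (IsRegularLocalRing.iff_finrank_cotangentSpace (Localization.AtPrime P)).1
      inferInstance
    rw [IsLocalization.AtPrime.ringKrullDim_eq_height P (Localization.AtPrime P), hd] at h1
    exact_mod_cast h1.symm
  · have h1 : algebraMap _ (Localization.AtPrime P) g ∈
        Ideal.map (algebraMap (MvPolynomial ι K) (Localization.AtPrime P))
          (Ideal.span (Set.range x)) := by
      rw [Ideal.map_span, ← Set.range_comp]
      exact hyspan ▸ algebraMap_mem_maximalIdeal P hg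
    exact (IsLocalization.algebraMap_mem_map_algebraMap_iff P.primeCompl _ _ _).1 h1

theorem linearIndependent_grad {K ι τ L : Type*} [Field K] [Finite ι] [Field L]
    [Algebra K L] (φ : MvPolynomial ι K →ₐ[K] L) {P : Ideal (MvPolynomial ι K)}
    (hP : P = RingHom.ker φ) {x : τ → MvPolynomial ι K}
    (hli : LinearIndependent (MvPolynomial ι K ⧸ P)
      (fun i v => Ideal.Quotient.mk P (pderiv v (x i)))) :
    LinearIndependent L (fun i => grad φ (x i)) :=
  hli.quotient_lift (fun a ha => by rwa [hP] at ha) (fun a ha => by rwa [hP])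

/-- In characteristic zero, the height of the ideal of a point with coordinates in a field is the
dimension of its conormal space. -/
theorem height_ker_eq_finrank_conormal {K ι L : Type*} [Field K] [CharZero K] [Finite ι] [Field L]
    [Algebra K L] (φ : MvPolynomial ι K →ₐ[K] L) :
    (RingHom.ker φ).height = Module.finrank L (conormal φ) := by
  have hp : (RingHom.ker φ).IsPrime := RingHom.ker_isPrime φ
  obtain ⟨d, x, hx, hd, hcot, hgen⟩ := exists_basis_of_prime (RingHom.ker φ)
  -- Elements of the kernel are combinations of the `x i` up to a denominator that does not vanish
  -- at the point, so the gradients of the `x i` span.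
  have hconormal : conormal φ = Submodule.span L (Set.range fun i => grad φ (x i)) := by
    apply le_antisymm
    · rw [conormal, Submodule.span_le]
      rintro _ ⟨h, hh, rfl⟩
      obtain ⟨s, hs, hsh⟩ := hgen h hh
      exact grad_mem_span_of_mul_mem φ hx (s := s) (fun h0 => hs h0) hh hsh
    · rw [Submodule.span_le]
      rintro _ ⟨i, rfl⟩
      exact Submodule.subset_span ⟨x i, hx i, rfl⟩
  have hli : LinearIndependent L (fun i => grad φ (x i)) :=
    linearIndependent_grad φ rfl (linearIndependent_pderiv_of_toCotangent _ hx hcot)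
  rw [hd, hconormal, finrank_span_eq_card hli, Fintype.card_fin]

end MvPolynomial

/-! ### Ranks of matrices under specialization. -/

namespace Matrix

/-- Over a field, the rank is the size of a nonvanishing minor. -/
theorem exists_submatrix_det_ne_zero {F m n : Type*} [Field F] [Finite m] [Fintype n]
    (M : Matrix m n F) :
    ∃ (a : Fin M.rank → m) (b : Fin M.rank → n), (M.submatrix a b).det ≠ 0 := by
  classical
  have := Fintype.ofFinite m
  obtain ⟨ι, a, ha, hspan, hli⟩ := exists_linearIndependent' F M.row
  have := Finite.of_injective a ha
  have := Fintype.ofFinite ι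
  have h1 : (M.submatrix a id).rank = M.rank := by
    rw [rank_eq_finrank_span_row, rank_eq_finrank_span_row, ← hspan]
    rfl
  have hcard : Fintype.card ι = M.rank := by
    rw [rank_eq_finrank_span_row, ← hspan, finrank_span_eq_card hli]
  obtain ⟨ι', b, hb, hspan', hli'⟩ := exists_linearIndependent' F (M.submatrix a id).col
  have := Finite.of_injective b hb
  have := Fintype.ofFinite ι'
  have hcard' : Fintype.card ι' = M.rank := by
    rw [← h1, rank_eq_finrank_span_cols, ← hspan', finrank_span_eq_card hli']
  let e := (Fintype.equivFinOfCardEq hcard).symm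
  let e' := (Fintype.equivFinOfCardEq hcard').symm
  refine ⟨a ∘ e, b ∘ e', ?_⟩
  have h2 : LinearIndependent F (M.submatrix (a ∘ e) (b ∘ e')).col := by
    have h3 := hli'.comp e' e'.injective
    have h4 := h3.map' (LinearEquiv.funCongrLeft F F e).toLinearMap (LinearEquiv.ker _)
    exact h4
  rw [linearIndependent_cols_iff_isUnit, isUnit_iff_isUnit_det] at h2
  exact h2.ne_zero

/-- A minor that is nonzero under `β` is nonzero under `α`: the rank can only drop under
specialization. -/
theorem rank_map_le_of_ker_le {S F F' m n : Type*} [CommRing S] [Field F] [Field F'] [Finite m]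
    [Fintype n] (M : Matrix m n S) (α : S →+* F) (β : S →+* F')
    (h : RingHom.ker α ≤ RingHom.ker β) : (M.map β).rank ≤ (M.map α).rank := by
  classical
  obtain ⟨a, b, hab⟩ := (M.map β).exists_submatrix_det_ne_zero
  have h1 : ((M.map α).submatrix a b).det ≠ 0 := by
    intro h0
    apply hab
    rw [show (M.map α).submatrix a b = α.mapMatrix (M.submatrix a b) from rfl,
      ← RingHom.map_det] at h0
    rw [show (M.map β).submatrix a b = β.mapMatrix (M.submatrix a b) from rfl,
      ← RingHom.map_det]
    exact h h0
  have h2 := (M.map α).rank_submatrix_le a b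
  rwa [rank_of_det_ne_zero h1, Fintype.card_fin] at h2

theorem rank_map_eq_of_ker_eq {S F F' m n : Type*} [CommRing S] [Field F] [Field F'] [Finite m]
    [Fintype n] (M : Matrix m n S) (α : S →+* F) (β : S →+* F')
    (h : RingHom.ker α = RingHom.ker β) : (M.map α).rank = (M.map β).rank :=
  le_antisymm (M.rank_map_le_of_ker_le β α h.ge) (M.rank_map_le_of_ker_le α β h.le)

/-- Carries the full row rank of the Jacobian matrix from the residue field of `p` to that of Δ_m.
-/
theorem linearIndependent_map_of_ker_le {S F F' m n : Type*} [CommRing S] [Field F] [Field F']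
    [Finite m] [Finite n] (M : m → n → S) (α : S →+* F) (β : S →+* F')
    (h : RingHom.ker α ≤ RingHom.ker β) (hli : LinearIndependent F' fun x y => β (M x y)) :
    LinearIndependent F fun x y => α (M x y) := by
  have := Fintype.ofFinite m
  have := Fintype.ofFinite n
  have h1 := (Matrix.of M).rank_map_le_of_ker_le α β h
  rw [rank_eq_finrank_span_row, rank_eq_finrank_span_row] at h1
  rw [linearIndependent_iff_card_eq_finrank_span] at hli ⊢
  refine le_antisymm (hli.le.trans h1) (finrank_range_le_card _)

theorem finrank_ker_transpose_add_rank {F m n : Type*} [Field F] [Fintype m] [Fintype n]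
    (M : Matrix m n F) :
    Module.finrank F (LinearMap.ker M.transpose.mulVecLin) + M.rank = Fintype.card m := by
  rw [← rank_transpose, add_comm]
  have := LinearMap.finrank_range_add_finrank_ker M.transpose.mulVecLin
  rwa [Module.finrank_fintype_fun_eq_card] at this

end Matrix

/-! ### The sequence μ_{k,i} and the existence of the index. -/

noncomputable section

namespace DifferenceAlgebra

open MvPolynomial

variable {K : Type*} [Field K] {n r : ℕ}

theorem pderiv_transform (σ : K →+* K) (c : Fin n) (q : ℕ) (a : DiffPoly K n) :
    pderiv (c, q + 1) (transform σ a) = transform σ (pderiv (c, q) a) := by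
  have hinj : Function.Injective fun v : Fin n × ℕ => (v.1, v.2 + 1) := by
    rintro ⟨a, b⟩ ⟨a', b'⟩ h
    simpa using h
  have h1 := pderiv_rename (R := K) hinj (c, q) (MvPolynomial.map σ a)
  simp only at h1
  simp only [transform, RingHom.comp_apply, AlgHom.toRingHom_eq_coe, RingHom.coe_coe]
  rw [h1, pderiv_map]

theorem pderiv_iterate_transform_eq_zero (σ : K →+* K) (f : Fin r → DiffPoly K n) {c : Fin n}
    {q l : ℕ} (h : maxOrder f + l < q) (j : Fin r) :
    pderiv (c, q) ((transform σ)^[l] (f j)) = 0 :=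
  pderiv_eq_zero_of_notMem_vars fun hv =>
    absurd (order_iterate_transform_le σ f j l _ hv) (by simpa using h)

theorem mu_add_rank (σ : K →+* K) (f : Fin r → DiffPoly K n) (p : Ideal (DiffPoly K n))
    [p.IsPrime] (k i : ℕ) :
    mu σ f p k i + ((pseudoJacobian σ f k i).map (algebraMap (DiffPoly K n) p.ResidueField)).rank
      = k * r := by
  have := Matrix.finrank_ker_transpose_add_rank
    ((pseudoJacobian σ f k i).map (algebraMap (DiffPoly K n) p.ResidueField))
  simpa [mu] using this

theorem pseudoJacobian_succ (σ : K →+* K) (f : Fin r → DiffPoly K n) (k : ℕ) {i : ℕ}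
    (hi : maxOrder f ≤ i + 1) :
    pseudoJacobian σ f k (i + 1) = (pseudoJacobian σ f k i).map (transform σ) := by
  ext1 x y
  simp only [pseudoJacobian, Matrix.of_apply, Matrix.map_apply]
  rw [← pderiv_transform, ← Function.iterate_succ_apply' (transform σ),
    show i + 1 + 1 - maxOrder f + (x.1 : ℕ) = (i + 1 - maxOrder f + x.1).succ by omega,
    show i + 1 + 1 + (y.1 : ℕ) = i + 1 + y.1 + 1 by omega]

/-- J_{k,i+1} is the transform of J_{k,i}, and a σ-prime ideal is its own preimage under the
transform, so the rank over the residue field of `p` is unchanged. -/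
theorem mu_succ_right (σ : K →+* K) (f : Fin r → DiffPoly K n) (p : Ideal (DiffPoly K n))
    [p.IsPrime] (hp : IsDiffPrime (transform σ) p) (k : ℕ) {i : ℕ} (hi : maxOrder f ≤ i + 1) :
    mu σ f p k (i + 1) = mu σ f p k i := by
  have h1 := mu_add_rank σ f p k i
  have h2 := mu_add_rank σ f p k (i + 1)
  have h3 : ((pseudoJacobian σ f k (i + 1)).map
      (algebraMap (DiffPoly K n) p.ResidueField)).rank =
      ((pseudoJacobian σ f k i).map (algebraMap (DiffPoly K n) p.ResidueField)).rank := by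
    rw [pseudoJacobian_succ σ f k hi, Matrix.map_map]
    refine Matrix.rank_map_eq_of_ker_eq (pseudoJacobian σ f k i)
      ((algebraMap (DiffPoly K n) p.ResidueField).comp (transform σ)) _ ?_
    rw [← RingHom.comap_ker, Ideal.ker_algebraMap_residueField]
    exact hp.eq_comap.symm
  omega

/-- The vectors in the left kernel of `J_{k,i}`, extended by zero. -/
def leftKer (σ : K →+* K) (f : Fin r → DiffPoly K n) (p : Ideal (DiffPoly K n)) [p.IsPrime]
    (k i : ℕ) : Submodule p.ResidueField (ℕ → Fin r → p.ResidueField) where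
  carrier := {v | (∀ a, k ≤ a → v a = 0) ∧ ∀ c q, i < q →
    ∑ a ∈ Finset.range k, ∑ j, v a j * algebraMap (DiffPoly K n) p.ResidueField
      (pderiv (c, q) ((transform σ)^[i + 1 - maxOrder f + a] (f j))) = 0}
  add_mem' {v w} hv hw := by
    refine ⟨fun a ha => by simp [hv.1 a ha, hw.1 a ha], fun c q hq => ?_⟩
    simp only [Pi.add_apply, add_mul, Finset.sum_add_distrib, hv.2 c q hq, hw.2 c q hq, add_zero]
  zero_mem' := by simp
  smul_mem' t v hv := by
    refine ⟨fun a ha => by simp [hv.1 a ha], fun c q hq => ?_⟩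
    simp only [Pi.smul_apply, smul_eq_mul, mul_assoc, ← Finset.mul_sum, hv.2 c q hq, mul_zero]

theorem mem_leftKer {σ : K →+* K} {f : Fin r → DiffPoly K n} {p : Ideal (DiffPoly K n)}
    [p.IsPrime] {k i : ℕ} {v : ℕ → Fin r → p.ResidueField} :
    v ∈ leftKer σ f p k i ↔ (∀ a, k ≤ a → v a = 0) ∧ ∀ c q, i < q →
    ∑ a ∈ Finset.range k, ∑ j, v a j * algebraMap (DiffPoly K n) p.ResidueField
      (pderiv (c, q) ((transform σ)^[i + 1 - maxOrder f + a] (f j))) = 0 := Iff.rfl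

/-- The left kernel of `J_{k,i}` as a space of finite sequences. -/
def leftKerEquiv (σ : K →+* K) (f : Fin r → DiffPoly K n) (p : Ideal (DiffPoly K n)) [p.IsPrime]
    (k : ℕ) {i : ℕ} (hi : maxOrder f ≤ i + 1) :
    leftKer σ f p k i ≃ₗ[p.ResidueField] LinearMap.ker
      (((pseudoJacobian σ f k i).map (algebraMap (DiffPoly K n) p.ResidueField)).transpose
        ).mulVecLin where
  toFun v := ⟨fun x => v.1 x.1 x.2, by
    rw [LinearMap.mem_ker]
    ext y
    have := v.2.2 y.2 (i + 1 + y.1) (by omega)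
    rw [Finset.sum_range] at this
    simp only [Matrix.mulVecLin_apply, Matrix.mulVec, dotProduct, Matrix.transpose_apply,
      Matrix.map_apply, pseudoJacobian, Matrix.of_apply, Fintype.sum_prod_type, Pi.zero_apply]
    rw [← this]
    exact Finset.sum_congr rfl fun a _ => Finset.sum_congr rfl fun j _ => mul_comm _ _⟩
  map_add' v w := rfl
  map_smul' t v := rfl
  invFun w := ⟨fun a j => if h : a < k then w.1 (⟨a, h⟩, j) else 0, by
    refine ⟨fun a ha => by ext; simp [not_lt.2 ha], fun c q hq => ?_⟩
    rw [Finset.sum_range]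
    by_cases hqk : q < i + 1 + k
    · have h1 := congrFun ((LinearMap.mem_ker).1 w.2) (⟨q - (i + 1), by omega⟩, c)
      simp only [Matrix.mulVecLin_apply, Matrix.mulVec, dotProduct, Matrix.transpose_apply,
        Matrix.map_apply, pseudoJacobian, Matrix.of_apply, Fintype.sum_prod_type,
        Pi.zero_apply] at h1
      refine Eq.trans ?_ h1
      refine Finset.sum_congr rfl fun a _ => Finset.sum_congr rfl fun j _ => ?_
      simp only
      rw [dif_pos a.2, mul_comm, show i + 1 + (q - (i + 1)) = q by omega]
    -- The rows of J_{k,i} have order at most i + k, so the conditions at larger `q` hold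
    -- automatically.
    · refine Finset.sum_eq_zero fun a _ => Finset.sum_eq_zero fun j _ => ?_
      rw [pderiv_iterate_transform_eq_zero σ f (by have := a.2; omega), map_zero, mul_zero]⟩
  left_inv v := by
    ext a j
    by_cases h : a < k
    · simp [h]
    · simp [h, v.2.1 a (not_lt.1 h)]
  right_inv w := by
    ext x
    simp

theorem finrank_leftKer (σ : K →+* K) (f : Fin r → DiffPoly K n) (p : Ideal (DiffPoly K n))
    [p.IsPrime] (k : ℕ) {i : ℕ} (hi : maxOrder f ≤ i + 1) :
    Module.finrank p.ResidueField (leftKer σ f p k i) = mu σ f p k i :=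
  (leftKerEquiv σ f p k hi).finrank_eq

/-- The last components of the elements of the left kernel of `J_{k+1,i}`. -/
def leftKerLast (σ : K →+* K) (f : Fin r → DiffPoly K n) (p : Ideal (DiffPoly K n)) [p.IsPrime]
    (k i : ℕ) : Submodule p.ResidueField (Fin r → p.ResidueField) :=
  (leftKer σ f p (k + 1) i).map (LinearMap.proj k)

theorem leftKer_succ_inf_ker (σ : K →+* K) (f : Fin r → DiffPoly K n) (p : Ideal (DiffPoly K n))
    [p.IsPrime] (k i : ℕ) {v : ℕ → Fin r → p.ResidueField} :
    v ∈ leftKer σ f p k i ↔ v ∈ leftKer σ f p (k + 1) i ∧ v k = 0 := by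
  simp only [mem_leftKer, Finset.sum_range_succ]
  constructor
  · rintro ⟨h1, h2⟩
    refine ⟨⟨fun a ha => h1 a (by omega), fun c q hq => ?_⟩, h1 k le_rfl⟩
    rw [h2 c q hq, h1 k le_rfl]
    simp
  · rintro ⟨⟨h1, h2⟩, h3⟩
    refine ⟨fun a ha => ?_, fun c q hq => ?_⟩
    · rcases ha.lt_or_eq with h | rfl
      · exact h1 a h
      · exact h3
    · simpa [h3] using h2 c q hq

/-- Rank–nullity for the projection to the component of index `k`, whose kernel is the left kernel
of J_{k,i}. The increments of μ become dimensions of subspaces of one fixed space. -/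
theorem mu_succ_left (σ : K →+* K) (f : Fin r → DiffPoly K n) (p : Ideal (DiffPoly K n))
    [p.IsPrime] (k : ℕ) {i : ℕ} (hi : maxOrder f ≤ i + 1) :
    mu σ f p (k + 1) i =
      mu σ f p k i + Module.finrank p.ResidueField (leftKerLast σ f p k i) := by
  have : Module.Finite p.ResidueField (leftKer σ f p (k + 1) i) :=
    Module.Finite.equiv (leftKerEquiv σ f p (k + 1) hi).symm
  let T := (LinearMap.proj k : (ℕ → Fin r → p.ResidueField) →ₗ[p.ResidueField] _).domRestrict
    (leftKer σ f p (k + 1) i)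
  have h1 := T.finrank_range_add_finrank_ker
  have h2 : LinearMap.range T = leftKerLast σ f p k i := LinearMap.range_domRestrict _ _
  have hle : leftKer σ f p k i ≤ leftKer σ f p (k + 1) i := fun v hv =>
    ((leftKer_succ_inf_ker σ f p k i).1 hv).1
  have h3 : LinearMap.ker T = (leftKer σ f p k i).comap (leftKer σ f p (k + 1) i).subtype := by
    ext v
    rw [Submodule.mem_comap, Submodule.subtype_apply, leftKer_succ_inf_ker σ f p k i]
    exact ⟨fun h => ⟨v.2, h⟩, fun h => h.2⟩
  rw [h2, h3, (Submodule.comapSubtypeEquivOfLe hle).finrank_eq, finrank_leftKer σ f p _ hi,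
    finrank_leftKer σ f p _ hi] at h1
  omega

/-- The first block of rows of J_{k+2,i} has order at most i + 1, so it contributes nothing to
columns of order greater than i + 1. Dropping the first component therefore yields a left kernel
vector of J_{k+1,i+1} with the same last component. -/
theorem leftKerLast_succ_le (σ : K →+* K) (f : Fin r → DiffPoly K n) (p : Ideal (DiffPoly K n))
    [p.IsPrime] (k : ℕ) {i : ℕ} (hi : maxOrder f ≤ i + 1) :
    leftKerLast σ f p (k + 1) i ≤ leftKerLast σ f p k (i + 1) := by
  rintro _ ⟨v, hv, rfl⟩
  refine ⟨fun a => v (a + 1), ⟨fun a ha => hv.1 _ (by omega), fun c q hq => ?_⟩, rfl⟩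
  have h1 := hv.2 c q (by omega)
  rw [Finset.sum_range_succ'] at h1
  have h2 : ∑ j, v 0 j * algebraMap (DiffPoly K n) p.ResidueField
      (pderiv (c, q) ((transform σ)^[i + 1 - maxOrder f + 0] (f j))) = 0 :=
    Finset.sum_eq_zero fun j _ => by
      rw [pderiv_iterate_transform_eq_zero σ f (by omega), map_zero, mul_zero]
  rw [h2, add_zero] at h1
  rw [← h1]
  refine Finset.sum_congr rfl fun a _ => Finset.sum_congr rfl fun j _ => ?_
  rw [show i + 1 + 1 - maxOrder f + a = i + 1 - maxOrder f + (a + 1) by omega]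

theorem mu_le_succ (σ : K →+* K) (f : Fin r → DiffPoly K n) (p : Ideal (DiffPoly K n))
    [p.IsPrime] (k : ℕ) {i : ℕ} (hi : maxOrder f ≤ i + 1) :
    mu σ f p k i ≤ mu σ f p (k + 1) i := by
  rw [mu_succ_left σ f p k hi]
  omega

/-- The increments of the sequence `k ↦ μ_{k,i}` are nonincreasing. -/
theorem mu_concave (σ : K →+* K) (f : Fin r → DiffPoly K n) (p : Ideal (DiffPoly K n))
    [p.IsPrime] (hp : IsDiffPrime (transform σ) p) (k : ℕ) {i : ℕ} (hi : maxOrder f ≤ i + 1) :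
    mu σ f p (k + 2) i + mu σ f p k i ≤ 2 * mu σ f p (k + 1) i := by
  have h1 := mu_succ_left σ f p k hi
  have h2 : mu σ f p (k + 2) i = _ := mu_succ_left σ f p (k + 1) hi
  have h3 := mu_succ_left σ f p k (i := i + 1) (by omega)
  rw [mu_succ_right σ f p hp _ hi, mu_succ_right σ f p hp _ hi] at h3
  have h4 := Submodule.finrank_mono (leftKerLast_succ_le σ f p k hi)
  omega

/-- The increments are nonnegative and nonincreasing, so they stay zero once they vanish. -/
theorem mu_eq_of_le (σ : K →+* K) (f : Fin r → DiffPoly K n) (p : Ideal (DiffPoly K n))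
    [p.IsPrime] (hp : IsDiffPrime (transform σ) p) {k : ℕ} {i : ℕ} (hi : maxOrder f ≤ i + 1)
    (hk : mu σ f p k i = mu σ f p (k + 1) i) {k' : ℕ} (h : k ≤ k') :
    mu σ f p k' i = mu σ f p (k' + 1) i := by
  induction k', h using Nat.le_induction with
  | base => exact hk
  | succ m _ ih =>
    have h1 := mu_concave σ f p hp m hi
    have h2 := mu_le_succ σ f p (m + 1) hi
    simp only [show m + 1 + 1 = m + 2 from rfl] at *
    omega

/-- A bounded sequence `k ↦ μ_{k,i}` defines a difference index. -/
theorem exists_isDifferenceIndex (σ : K →+* K) (f : Fin r → DiffPoly K n)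
    (p : Ideal (DiffPoly K n)) [p.IsPrime] (hp : IsDiffPrime (transform σ) p) {i₀ N : ℕ}
    (hi₀ : maxOrder f - 1 = i₀) (hN : ∀ k, mu σ f p k i₀ ≤ N) :
    ∃! ω : ℕ, IsDifferenceIndex σ f p ω := by
  classical
  have hi : maxOrder f ≤ i₀ + 1 := by omega
  have hconst : ∀ k i, i₀ ≤ i → mu σ f p k i = mu σ f p k i₀ := by
    intro k i h
    induction i, h using Nat.le_induction with
    | base => rfl
    | succ m hm ih => rw [mu_succ_right σ f p hp k (by omega), ih]
  have hex : ∃ k, mu σ f p k i₀ = mu σ f p (k + 1) i₀ := by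
    by_contra! hne
    -- Without a vanishing increment the sequence would grow at least linearly, against the bound
    -- `N`.
    have hlt : ∀ k, k ≤ mu σ f p k i₀ := by
      intro k
      induction k with
      | zero => exact Nat.zero_le _
      | succ k ih => exact ih.trans_lt ((mu_le_succ σ f p k hi).lt_of_ne (hne k))
    exact absurd ((hlt (N + 1)).trans (hN _)) (by omega)
  refine ⟨Nat.find hex, fun i h => ⟨fun k hk => ?_, fun k hk => ?_⟩, fun ω hω => ?_⟩
  · rw [hconst k i (hi₀ ▸ h), hconst (k + 1) i (hi₀ ▸ h)]
    exact (mu_le_succ σ f p k hi).lt_of_ne (Nat.find_min hex hk)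
  · rw [hconst k i (hi₀ ▸ h), hconst (k + 1) i (hi₀ ▸ h)]
    exact mu_eq_of_le σ f p hp hi (Nat.find_spec hex) hk
  · obtain ⟨h1, h2⟩ := hω i₀ hi₀.le
    symm
    rw [Nat.find_eq_iff]
    exact ⟨h2 ω le_rfl, fun k hk => (h1 k hk).ne⟩

end DifferenceAlgebra

end

/-! ### Conormal spaces of projections and Jacobian blocks. -/

theorem Matrix.rank_submatrix_of_cover {F m n m₀ n₀ : Type*} [Field F] [Finite m] [Fintype n]
    [Finite m₀] [Fintype n₀] (M : Matrix m n F) (ρ : m₀ → m) (ε : n₀ → n)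
    (hρ : ∀ x, x ∉ Set.range ρ → ∀ y, M x y = 0) (hε : Function.Surjective ε) :
    (M.submatrix ρ ε).rank = M.rank := by
  classical
  have := Fintype.ofFinite m
  have := Fintype.ofFinite m₀
  refine le_antisymm (M.rank_submatrix_le ρ ε) ?_
  obtain ⟨a, b, hab⟩ := M.exists_submatrix_det_ne_zero
  have ha : ∀ x, ∃ x₀, ρ x₀ = a x := by
    intro x
    by_contra hx
    exact hab (Matrix.det_eq_zero_of_row_eq_zero x fun y => hρ _ hx _)
  choose a' ha' using ha
  choose b' hb' using fun y => hε (b y)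
  have h1 : ((M.submatrix ρ ε).submatrix a' b').det ≠ 0 := by
    rw [Matrix.submatrix_submatrix]
    convert hab using 3
    · ext x; exact ha' x
    · ext y; exact hb' y
  have h2 := (M.submatrix ρ ε).rank_submatrix_le a' b'
  rwa [Matrix.rank_of_det_ne_zero h1, Fintype.card_fin] at h2

namespace MvPolynomial

/-- The dimension of the conormal space of the projection of a point to some of its coordinates,
in terms of the Jacobian matrix with respect to the other coordinates. -/
theorem finrank_conormal_rename_add_rank {K ι ι' τ L : Type*} [Field K] [Field L] [CharZero L]
    [Algebra K L] [Finite ι'] [Fintype τ] {j : ι → ι'} (hj : Function.Injective j)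
    [Fintype {v // v ∉ Set.range j}] (φ : MvPolynomial ι' K →ₐ[K] L) (x : τ → MvPolynomial ι' K)
    (hx : conormal φ = Submodule.span L (Set.range fun t => grad φ (x t)))
    (hli : LinearIndependent L fun t => grad φ (x t)) :
    Module.finrank L (conormal (φ.comp (rename j))) +
      (Matrix.of fun t (v : {v // v ∉ Set.range j}) => grad φ (x t) v).rank = Fintype.card τ := by
  set M : Matrix τ {v // v ∉ Set.range j} L := Matrix.of fun t v => grad φ (x t) v
  rw [← M.finrank_ker_transpose_add_rank]
  congr 1
  have hM : ∀ c, c ∈ LinearMap.ker M.transpose.mulVecLin ↔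
      ∀ v ∉ Set.range j, (∑ t, c t • grad φ (x t)) v = 0 := by
    intro c
    rw [LinearMap.mem_ker]
    constructor
    · intro h v hv
      have := congrFun h ⟨v, hv⟩
      simp only [Matrix.mulVecLin_apply, Matrix.mulVec, dotProduct, Matrix.transpose_apply, M,
        Matrix.of_apply, Pi.zero_apply] at this
      rw [← this, Finset.sum_apply]
      exact Finset.sum_congr rfl fun t _ => mul_comm _ _
    · intro h
      ext v
      rw [Pi.zero_apply, ← h v v.2, Finset.sum_apply]
      simp only [Matrix.mulVecLin_apply, Matrix.mulVec, dotProduct, Matrix.transpose_apply, M,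
        Matrix.of_apply]
      exact Finset.sum_congr rfl fun t _ => mul_comm _ _
  -- The left kernel of `M` parametrizes the combinations of the gradients that are supported on the
  -- range of `j`. `Ψ` restricts such a combination to `ι`; on this kernel it is injective, and its
  -- image is the conormal space of the projection.
  let Ψ : (τ → L) →ₗ[L] (ι → L) :=
    (LinearMap.funLeft L L j).comp (Fintype.linearCombination L fun t => grad φ (x t))
  have hΨ : ∀ c, Ψ c = (∑ t, c t • grad φ (x t)) ∘ j := fun c => rfl
  have hmap : (LinearMap.ker M.transpose.mulVecLin).map Ψ = conormal (φ.comp (rename j)) := by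
    apply le_antisymm
    · rintro _ ⟨c, hc, rfl⟩
      rw [hΨ]
      refine comp_mem_conormal_rename hj φ ?_ ((hM c).1 hc)
      rw [hx]
      exact Submodule.sum_mem _ fun t _ =>
        Submodule.smul_mem _ _ (Submodule.subset_span ⟨t, rfl⟩)
    · rw [conormal, Submodule.span_le]
      rintro _ ⟨g, hg, rfl⟩
      have h1 : grad φ (rename j g) ∈ conormal φ := Submodule.subset_span ⟨_, hg, rfl⟩
      rw [hx, Submodule.mem_span_range_iff_exists_fun] at h1
      obtain ⟨c, hc⟩ := h1
      refine ⟨c, (hM c).2 fun v hv => ?_, ?_⟩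
      · rw [hc, grad, pderiv_eq_zero_of_notMem_vars, map_zero]
        classical
        intro hmem
        obtain ⟨w, _, rfl⟩ := Finset.mem_image.1 (vars_rename j g hmem)
        exact hv ⟨w, rfl⟩
      · rw [hΨ, hc]
        ext v
        simp only [Function.comp_apply, grad, AlgHom.comp_apply]
        rw [pderiv_rename hj]
  rw [← hmap]
  rw [← LinearMap.range_domRestrict]
  refine LinearMap.finrank_range_of_inj ?_
  rintro ⟨c, hc⟩ ⟨c', hc'⟩ hcc
  have hd : c - c' ∈ LinearMap.ker M.transpose.mulVecLin := sub_mem hc hc'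
  have h0 : ∑ t, (c - c') t • grad φ (x t) = 0 := by
    ext v
    by_cases hv : v ∈ Set.range j
    · obtain ⟨w, rfl⟩ := hv
      have : Ψ (c - c') = 0 := by rw [map_sub, sub_eq_zero]; exact hcc
      exact congrFun this w
    · exact (hM _).1 hd v hv
  have hcc' : c = c' := by
    funext t
    exact sub_eq_zero.1 (Fintype.linearIndependent_iff.1 hli _ h0 t)
  subst hcc'
  rfl

end MvPolynomial

/-! ### The ideals Δ_m and Δ, their primality, and the identification of Δ with the ideal of `p`. -/

noncomputable section

namespace DifferenceAlgebra

open MvPolynomial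

theorem ker_toFracQuot {R : Type*} [CommRing R] (I : Ideal R) :
    RingHom.ker (toFracQuot I) = I := by
  ext a
  rw [RingHom.mem_ker, toFracQuot, RingHom.comp_apply,
    map_eq_zero_iff _ (IsFractionRing.injective (R ⧸ I) (FractionRing (R ⧸ I))),
    Ideal.Quotient.eq_zero_iff_mem]

section

variable {R : Type*} [CommRing R] (φ : R →+* R) (S : Set R)

theorem subset_diffSpan : S ⊆ diffSpan φ S := fun a ha => by
  rw [SetLike.mem_coe, diffSpan, Submodule.mem_sInf]
  exact fun I hI => hI.2 ha

theorem isDiffIdeal_diffSpan : IsDiffIdeal φ (diffSpan φ S) := fun a ha => by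
  rw [diffSpan, Submodule.mem_sInf] at ha ⊢
  exact fun I hI => hI.1 a (ha I hI)

variable {φ S}

theorem diffSpan_le {I : Ideal R} (hI : IsDiffIdeal φ I) (hS : S ⊆ I) : diffSpan φ S ≤ I :=
  sInf_le ⟨hI, hS⟩

theorem IsDiffIdeal.iterate_mem {I : Ideal R} (hI : IsDiffIdeal φ I) {a : R} (ha : a ∈ I) (l : ℕ) :
    φ^[l] a ∈ I := by
  induction l with
  | zero => exact ha
  | succ l ih => rw [Function.iterate_succ_apply']; exact hI _ ih

end

variable {K : Type*} [Field K] {n r : ℕ}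

instance (N : ℕ) : Finite {v : Fin n × ℕ // v.2 ≤ N} :=
  Finite.of_injective (β := Fin n × Fin (N + 1))
    (fun v => (v.1.1, ⟨v.1.2, Nat.lt_succ_of_le v.2⟩)) fun v w h => by
      simp only [Prod.mk.injEq, Fin.mk.injEq] at h
      exact Subtype.ext (Prod.ext h.1 h.2)

theorem toA_valA (N : ℕ) (b : A K n N) : toA N (valA K n N b) = b := by
  simp [valA, toA, killCompl_rename_app]

theorem valA_inclA {N N' : ℕ} (h : N ≤ N') (b : A K n N) :
    valA K n N' (inclA K n h b) = valA K n N b :=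
  RingHom.congr_fun (valA_comp_inclA h) b

theorem toA_valA_of_le {N N' : ℕ} (h : N ≤ N') (b : A K n N) :
    toA N' (valA K n N b) = inclA K n h b := by
  rw [← valA_inclA h, toA_valA]

theorem pderiv_toA {N : ℕ} {a : DiffPoly K n} (ha : ∀ v ∈ a.vars, v.2 ≤ N)
    (v : {v : Fin n × ℕ // v.2 ≤ N}) : pderiv v (toA N a) = toA N (pderiv v.1 a) := by
  conv_rhs => rw [← valA_toA ha]
  have h1 := pderiv_rename (R := K) (Subtype.val_injective (p := fun v : Fin n × ℕ => v.2 ≤ N)) v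
    (toA N a)
  have h2 : pderiv v.1 (valA K n N (toA N a)) = valA K n N (pderiv v (toA N a)) := h1
  rw [h2, toA_valA]

variable {σ : K →+* K} {f : Fin r → DiffPoly K n} {p : Ideal (DiffPoly K n)} [p.IsPrime]
  {hp : IsDiffPrime (transform σ) p}

theorem transformIn_mem_pTrunc {p : Ideal (DiffPoly K n)} (hp : IsDiffPrime (transform σ) p) (hf : ∀ j, f j ∈ p) (m : ℕ)
    (x : Fin m × Fin r) : transformIn σ f m x.1 x.2 ∈ pTrunc p (m + maxOrder f - 1) := by
  rw [pTrunc, Ideal.mem_comap, valA_transformIn σ f x.1.2]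
  exact hp.isDiffIdeal.iterate_mem (hf _) _

theorem algebraMap_mem_maximalIdeal_iff {N : ℕ} {g : A K n N} :
    algebraMap _ (B p N) g ∈ maximalIdeal (B p N) ↔ g ∈ pTrunc p N :=
  IsLocalization.AtPrime.to_map_mem_maximal_iff _ _ g

theorem linearIndependent_residue_pderiv (hqr : IsQuasiRegular σ f p hp) (m : ℕ) :
    LinearIndependent (ResidueField (B p (m + maxOrder f - 1)))
      (fun (x : Fin m × Fin r) (v : {v : Fin n × ℕ // v.2 ≤ m + maxOrder f - 1}) =>
        residue (B p (m + maxOrder f - 1))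
          (algebraMap _ _ (pderiv v (transformIn σ f m x.1 x.2)))) := by
  rcases Nat.eq_zero_or_pos m with rfl | hm
  · exact linearIndependent_empty_type
  · have h := hqr.jacobian m hm
    exact h.quotient_lift (φ := (residue (B p (m + maxOrder f - 1))).comp (algebraMap _ _))
      (fun a ha => (residue_algebraMap_eq_zero_iff (pTrunc p _)).2 ha)
      (fun a ha => (residue_algebraMap_eq_zero_iff (pTrunc p _)).1 ha)

theorem isPrime_DeltaTrunc (hf : ∀ j, f j ∈ p) (hqr : IsQuasiRegular σ f p hp) (m : ℕ) :
    (DeltaTrunc σ f p m).IsPrime :=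
  isPrime_span_of_linearIndependent (pTrunc p (m + maxOrder f - 1))
    (x := fun x : Fin m × Fin r => transformIn σ f m x.1 x.2)
    (transformIn_mem_pTrunc hp hf m) (linearIndependent_residue_pderiv hqr m)

theorem DeltaTrunc_le_maximalIdeal (hp : IsDiffPrime (transform σ) p) (hf : ∀ j, f j ∈ p) (m : ℕ) :
    DeltaTrunc σ f p m ≤ maximalIdeal (B p (m + maxOrder f - 1)) := by
  rw [DeltaTrunc, Ideal.span_le]
  rintro _ ⟨x, rfl⟩
  exact algebraMap_mem_maximalIdeal_iff.2 (transformIn_mem_pTrunc hp hf m x)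

theorem inclLoc_algebraMap {N : ℕ} (g : A K n N) :
    inclLoc p N (algebraMap _ _ g) = algebraMap _ (Localization.AtPrime p) (valA K n N g) :=
  Localization.localRingHom_to_map _ _ _ _ _

theorem inclB_algebraMap {N N' : ℕ} (h : N ≤ N') (g : A K n N) :
    inclB p h (algebraMap _ _ g) = algebraMap _ (B p N') (inclA K n h g) :=
  Localization.localRingHom_to_map _ _ _ _ _

theorem transformLoc_algebraMap (g : DiffPoly K n) :
    transformLoc σ p hp (algebraMap _ _ g) =
      algebraMap _ (Localization.AtPrime p) (transform σ g) :=
  Localization.localRingHom_to_map _ _ _ _ _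

theorem algebraMap_iterate_transform_mem_Delta (l : ℕ) (j : Fin r) :
    algebraMap _ (Localization.AtPrime p) ((transform σ)^[l] (f j)) ∈ Delta σ f p hp := by
  induction l with
  | zero => exact subset_diffSpan _ _ ⟨j, rfl⟩
  | succ l ih =>
    rw [Function.iterate_succ_apply', ← transformLoc_algebraMap (hp := hp)]
    exact isDiffIdeal_diffSpan _ _ _ ih

theorem DeltaTrunc_le_comap_Delta (m : ℕ) :
    DeltaTrunc σ f p m ≤ (Delta σ f p hp).comap (inclLoc p (m + maxOrder f - 1)) := by
  rw [DeltaTrunc, Ideal.span_le]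
  rintro _ ⟨x, rfl⟩
  rw [SetLike.mem_coe, Ideal.mem_comap, inclLoc_algebraMap, valA_transformIn σ f x.1.2]
  exact algebraMap_iterate_transform_mem_Delta _ _

/-- `Δ` is generated by the transforms of the system. -/
theorem Delta_le_map_span : Delta σ f p hp ≤
    (Ideal.span (Set.range fun x : ℕ × Fin r => (transform σ)^[x.1] (f x.2))).map
      (algebraMap _ (Localization.AtPrime p)) := by
  refine diffSpan_le (fun a ha => ?_) ?_
  · have h1 := Ideal.mem_map_of_mem (transformLoc σ p hp) ha
    rw [Ideal.map_map] at h1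
    have h2 : (transformLoc σ p hp).comp (algebraMap _ (Localization.AtPrime p)) =
        (algebraMap _ (Localization.AtPrime p)).comp (transform σ) :=
      RingHom.ext fun g => transformLoc_algebraMap (hp := hp) g
    rw [h2, ← Ideal.map_map] at h1
    refine Ideal.map_mono ?_ h1
    rw [Ideal.map_span, Ideal.span_le]
    rintro _ ⟨_, ⟨x, rfl⟩, rfl⟩
    refine Ideal.subset_span ⟨(x.1 + 1, x.2), ?_⟩
    exact Function.iterate_succ_apply' _ _ _
  · rintro _ ⟨j, rfl⟩
    exact Ideal.mem_map_of_mem _ (Ideal.subset_span ⟨(0, j), rfl⟩)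

/-- An element of `Δ` belongs to `Δ_m` for all large `m`. -/
theorem exists_forall_toA_mem_DeltaTrunc {g : DiffPoly K n}
    (hg : algebraMap _ (Localization.AtPrime p) g ∈ Delta σ f p hp) :
    ∃ m₀, ∀ m, m₀ ≤ m → algebraMap _ (B p (m + maxOrder f - 1))
      (toA (m + maxOrder f - 1) g) ∈ DeltaTrunc σ f p m := by
  obtain ⟨s, hs, hsg⟩ := (IsLocalization.algebraMap_mem_map_algebraMap_iff p.primeCompl
    (Localization.AtPrime p) _ _).1 (Delta_le_map_span hg)
  -- Truncation by `toA` is a ring homomorphism and sends f_j^{(l)} to a generator of Δ_m as soon as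
  -- l < m.
  have key : ∀ a ∈ Ideal.span (Set.range fun x : ℕ × Fin r => (transform σ)^[x.1] (f x.2)),
      ∃ m₀, ∀ m, m₀ ≤ m → algebraMap _ (B p (m + maxOrder f - 1))
        (toA (m + maxOrder f - 1) a) ∈ DeltaTrunc σ f p m := by
    intro a ha
    induction ha using Submodule.span_induction with
    | mem _ h =>
      obtain ⟨⟨l, j⟩, rfl⟩ := h
      exact ⟨l + 1, fun m hm => Ideal.subset_span ⟨(⟨l, hm⟩, j), rfl⟩⟩
    | zero => exact ⟨0, fun m _ => by rw [map_zero, map_zero]; exact zero_mem _⟩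
    | add a b _ _ ha hb =>
      obtain ⟨m₁, h₁⟩ := ha
      obtain ⟨m₂, h₂⟩ := hb
      refine ⟨max m₁ m₂, fun m hm => ?_⟩
      rw [map_add, map_add]
      exact add_mem (h₁ m (le_of_max_le_left hm)) (h₂ m (le_of_max_le_right hm))
    | smul a b _ hb =>
      obtain ⟨m₁, h₁⟩ := hb
      refine ⟨m₁, fun m hm => ?_⟩
      rw [smul_eq_mul, map_mul, map_mul]
      exact Ideal.mul_mem_left _ _ (h₁ m hm)
  obtain ⟨m₁, h₁⟩ := key _ hsg
  -- For such `m` the denominator `s` has order at most m - 1 + e, so truncation does not alter it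
  -- and it becomes a unit in the local ring.
  refine ⟨max m₁ (s.vars.sup Prod.snd + 1), fun m hm => ?_⟩
  have h2 := h₁ m (le_of_max_le_left hm)
  rw [map_mul, map_mul] at h2
  have hs' : toA (m + maxOrder f - 1) s ∉ pTrunc p (m + maxOrder f - 1) := by
    rw [pTrunc, Ideal.mem_comap, valA_toA]
    · exact hs
    · intro v hv
      have h3 : v.2 ≤ s.vars.sup Prod.snd := Finset.le_sup (f := Prod.snd) hv
      have := le_of_max_le_right hm
      omega
  have hu : IsUnit (algebraMap _ (B p (m + maxOrder f - 1)) (toA (m + maxOrder f - 1) s)) :=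
    IsLocalization.map_units (M := (pTrunc p (m + maxOrder f - 1)).primeCompl) _ ⟨_, hs'⟩
  exact (Ideal.unit_mul_mem_iff_mem _ hu).1 h2

/-- All large `m` bound the order of a difference polynomial. -/
theorem exists_forall_valA_toA (f : Fin r → DiffPoly K n) (g : DiffPoly K n) :
    ∃ m₀, ∀ m, m₀ ≤ m → valA K n (m + maxOrder f - 1) (toA (m + maxOrder f - 1) g) = g := by
  refine ⟨g.vars.sup Prod.snd + 1, fun m hm => valA_toA fun v hv => ?_⟩
  have h3 : v.2 ≤ g.vars.sup Prod.snd := Finset.le_sup (f := Prod.snd) hv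
  omega

/-- After clearing denominators, a product in Δ lies in Δ_m for large `m`; primality of Δ_m puts a
factor in Δ_m, and Δ_m maps into Δ. -/
theorem isPrime_Delta (hf : ∀ j, f j ∈ p) (hqr : IsQuasiRegular σ f p hp) :
    (Delta σ f p hp).IsPrime := by
  have hmem : ∀ g m, valA K n (m + maxOrder f - 1) (toA (m + maxOrder f - 1) g) = g →
      algebraMap _ (B p (m + maxOrder f - 1)) (toA (m + maxOrder f - 1) g) ∈ DeltaTrunc σ f p m →
      algebraMap _ (Localization.AtPrime p) g ∈ Delta σ f p hp := by
    intro g m h1 h2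
    have h3 := DeltaTrunc_le_comap_Delta (hp := hp) m h2
    rwa [Ideal.mem_comap, inclLoc_algebraMap, h1] at h3
  refine ⟨fun htop => ?_, fun {a b} hab => ?_⟩
  · obtain ⟨m, hm⟩ := exists_forall_toA_mem_DeltaTrunc (σ := σ) (f := f) (hp := hp) (g := 1)
      (htop ▸ Submodule.mem_top)
    have := hm m le_rfl
    rw [map_one, map_one] at this
    exact (isPrime_DeltaTrunc hf hqr m).one_notMem this
  · obtain ⟨⟨g, s⟩, hgs⟩ := IsLocalization.surj p.primeCompl a
    obtain ⟨⟨h, t⟩, hht⟩ := IsLocalization.surj p.primeCompl b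
    simp only at hgs hht
    have hs := IsLocalization.map_units (Localization.AtPrime p) s
    have ht := IsLocalization.map_units (Localization.AtPrime p) t
    have hgh : algebraMap _ (Localization.AtPrime p) (g * h) ∈ Delta σ f p hp := by
      rw [map_mul, ← hgs, ← hht, mul_mul_mul_comm]
      exact Ideal.mul_mem_right _ _ hab
    obtain ⟨m₁, h₁⟩ := exists_forall_toA_mem_DeltaTrunc hgh
    obtain ⟨m₂, h₂⟩ := exists_forall_valA_toA f g
    obtain ⟨m₃, h₃⟩ := exists_forall_valA_toA f h
    have h4 := h₁ (max m₁ (max m₂ m₃)) (by simp)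
    rw [map_mul, map_mul] at h4
    rcases (isPrime_DeltaTrunc hf hqr _).mem_or_mem h4 with h5 | h5
    · left
      have h6 := hmem g _ (h₂ _ (by simp)) h5
      rw [← hgs] at h6
      exact (Ideal.mul_unit_mem_iff_mem _ hs).1 h6
    · right
      have h6 := hmem h _ (h₃ _ (by simp)) h5
      rw [← hht] at h6
      exact (Ideal.mul_unit_mem_iff_mem _ ht).1 h6

/-- Under the hypotheses, `Δ` is the maximal ideal of the localization at `p`. -/
theorem algebraMap_mem_Delta_iff (hmin : IsMinimalDiffPrimeOver (transform σ) (Set.range f) p)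
    (hqr : IsQuasiRegular σ f p hp) {g : DiffPoly K n} :
    algebraMap _ (Localization.AtPrime p) g ∈ Delta σ f p hp ↔ g ∈ p := by
  have hf : ∀ j, f j ∈ p := fun j => hmin.prop.2 (subset_diffSpan _ _ ⟨j, rfl⟩)
  let q := (Delta σ f p hp).comap (algebraMap (DiffPoly K n) (Localization.AtPrime p))
  have hle : q ≤ p := by
    intro g hg
    obtain ⟨m₁, h₁⟩ := exists_forall_toA_mem_DeltaTrunc (hp := hp) hg
    obtain ⟨m₂, h₂⟩ := exists_forall_valA_toA f g
    have h3 := DeltaTrunc_le_maximalIdeal hp hf _ (h₁ (max m₁ m₂) (by simp))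
    rw [algebraMap_mem_maximalIdeal_iff, pTrunc, Ideal.mem_comap, h₂ _ (by simp)] at h3
    exact h3
  have hprime := isPrime_Delta hf hqr
  -- The reflexivity half of quasi-regularity makes the contraction of Δ a competitor in the
  -- minimality of `p`.
  have hq : IsDiffPrime (transform σ) q ∧ diffSpan (transform σ) (Set.range f) ≤ q := by
    have hd : IsDiffIdeal (transform σ) q := fun a ha => by
      rw [Ideal.mem_comap] at ha ⊢
      rw [← transformLoc_algebraMap (hp := hp)]
      exact isDiffIdeal_diffSpan _ _ _ ha
    refine ⟨⟨hd, fun a ha => ?_, Ideal.comap_isPrime _ _⟩, diffSpan_le hd ?_⟩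
    · rw [Ideal.mem_comap] at ha ⊢
      rw [← transformLoc_algebraMap (hp := hp)] at ha
      exact hqr.reflexive _ ha
    · rintro _ ⟨j, rfl⟩
      exact algebraMap_iterate_transform_mem_Delta (σ := σ) 0 j
  exact ⟨fun h => hle h, fun h => hmin.le_of_le hq hle h⟩

/-! ### Contractions to A_i and their heights. -/

/-- The residue map of `Δ_m` on `A_{m-1+e}`. -/
def toFracDelta (σ : K →+* K) (f : Fin r → DiffPoly K n) (p : Ideal (DiffPoly K n)) [p.IsPrime]
    (m : ℕ) : A K n (m + maxOrder f - 1) →ₐ[K] FracQuot (DeltaTrunc σ f p m) where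
  toRingHom := (toFracQuot (DeltaTrunc σ f p m)).comp (algebraMap _ (B p (m + maxOrder f - 1)))
  commutes' _ := rfl

theorem toFracDelta_apply (m : ℕ) (a : A K n (m + maxOrder f - 1)) :
    toFracDelta σ f p m a = toFracQuot (DeltaTrunc σ f p m) (algebraMap _ (B p _) a) := rfl

theorem toFracDelta_eq_zero_iff (m : ℕ) (a : A K n (m + maxOrder f - 1)) :
    toFracDelta σ f p m a = 0 ↔ algebraMap _ (B p _) a ∈ DeltaTrunc σ f p m := by
  rw [toFracDelta_apply, ← RingHom.mem_ker, ker_toFracQuot]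

/-- The contraction of `Δ_{i-e+1+h}` to `A_i`. -/
def DeltaTruncPoly (σ : K →+* K) (f : Fin r → DiffPoly K n) (p : Ideal (DiffPoly K n))
    [p.IsPrime] (i h : ℕ) : Ideal (A K n i) :=
  (DeltaTruncInter σ f p i h).comap (algebraMap _ (B p i))

theorem mem_DeltaTruncPoly {i h : ℕ} (g : A K n i) :
    g ∈ DeltaTruncPoly σ f p i h ↔ toFracDelta σ f p (i + 1 - maxOrder f + h)
      (inclA K n (show i ≤ i + 1 - maxOrder f + h + maxOrder f - 1 by omega) g) = 0 := by
  rw [toFracDelta_eq_zero_iff, DeltaTruncPoly, Ideal.mem_comap, DeltaTruncInter, Ideal.mem_comap,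
    inclB_algebraMap]

theorem isPrime_DeltaTruncPoly (hf : ∀ j, f j ∈ p) (hqr : IsQuasiRegular σ f p hp) (i h : ℕ) :
    (DeltaTruncPoly σ f p i h).IsPrime := by
  have := isPrime_DeltaTrunc hf hqr (i + 1 - maxOrder f + h)
  exact Ideal.comap_isPrime _ _ (H := Ideal.comap_isPrime _ _)

theorem DeltaTruncPoly_le_pTrunc (hp : IsDiffPrime (transform σ) p) (hf : ∀ j, f j ∈ p) (i h : ℕ) :
    DeltaTruncPoly σ f p i h ≤ pTrunc p i := by
  intro g hg
  rw [mem_DeltaTruncPoly, toFracDelta_eq_zero_iff] at hg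
  have h1 := DeltaTrunc_le_maximalIdeal hp hf _ hg
  rw [algebraMap_mem_maximalIdeal_iff, pTrunc, Ideal.mem_comap, valA_inclA] at h1
  exact h1

/-- The prime ideal `p` is contained in `Δ_m` for all large `m`, up to any given order. -/
theorem exists_forall_pTrunc_le (hmin : IsMinimalDiffPrimeOver (transform σ) (Set.range f) p)
    (hqr : IsQuasiRegular σ f p hp) (i : ℕ) :
    ∃ m₀, ∀ m, m₀ ≤ m → ∀ h : i ≤ m + maxOrder f - 1, ∀ g ∈ pTrunc p i,
      toFracDelta σ f p m (inclA K n h g) = 0 := by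
  -- Finite generation gives a single bound valid for the whole ideal.
  obtain ⟨S, hS⟩ := (isNoetherianRing_iff_ideal_fg _).1 inferInstance (pTrunc p i)
  have h1 : ∀ g ∈ S, ∃ m₀, ∀ m, m₀ ≤ m → ∀ h : i ≤ m + maxOrder f - 1,
      toFracDelta σ f p m (inclA K n h g) = 0 := by
    intro g hg
    have hg' : g ∈ pTrunc p i := hS ▸ Ideal.subset_span hg
    obtain ⟨m₀, h₀⟩ := exists_forall_toA_mem_DeltaTrunc
      ((algebraMap_mem_Delta_iff hmin hqr).2 hg')
    refine ⟨m₀, fun m hm h => ?_⟩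
    rw [toFracDelta_eq_zero_iff, ← toA_valA_of_le]
    exact h₀ m hm
  choose! M hM using h1
  refine ⟨S.sup M, fun m hm h g hg => ?_⟩
  have h2 : pTrunc p i ≤ RingHom.ker ((toFracDelta σ f p m).toRingHom.comp (inclA K n h)) := by
    rw [← hS, Ideal.span_le]
    exact fun g hg => hM g hg m ((Finset.le_sup hg).trans hm) h
  exact h2 hg

theorem exists_forall_DeltaTruncPoly_eq
    (hmin : IsMinimalDiffPrimeOver (transform σ) (Set.range f) p)
    (hqr : IsQuasiRegular σ f p hp) (i : ℕ) :
    ∃ h₀, ∀ h, h₀ ≤ h → DeltaTruncPoly σ f p i h = pTrunc p i := by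
  have hf : ∀ j, f j ∈ p := fun j => hmin.prop.2 (subset_diffSpan _ _ ⟨j, rfl⟩)
  obtain ⟨m₀, h₀⟩ := exists_forall_pTrunc_le hmin hqr i
  refine ⟨m₀, fun h hh => le_antisymm (DeltaTruncPoly_le_pTrunc hp hf i h) fun g hg => ?_⟩
  rw [mem_DeltaTruncPoly]
  exact h₀ _ (by omega) _ g hg

theorem pseudoJacobianIn_eq_map (k i s : ℕ) :
    pseudoJacobianIn σ f k i s = (pseudoJacobianIn σ f k i 0).map (inclA K n
      (show i + 1 - maxOrder f + k + 0 + maxOrder f - 1 ≤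
        i + 1 - maxOrder f + k + s + maxOrder f - 1 by omega)) := by
  conv_lhs => rw [pseudoJacobianIn, ← map_valA_pseudoJacobianIn σ f k i 0]
  ext1 x y
  exact toA_valA_of_le (by omega) _

/-- Under the constant rank hypothesis, the rank of `J_{k,i}` over the residue class field of
`Δ_{i-e+1+k}` is its rank over the residue class field of `p`. -/
theorem mu_add_rankOverDelta (hmin : IsMinimalDiffPrimeOver (transform σ) (Set.range f) p)
    (hqr : IsQuasiRegular σ f p hp) (hrank : HasConstantRanks σ f p) (k : ℕ) {i : ℕ}
    (hi : maxOrder f - 1 ≤ i) : mu σ f p k i + rankOverDelta σ f p k i 0 = k * r := by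
  have hf : ∀ j, f j ∈ p := fun j => hmin.prop.2 (subset_diffSpan _ _ ⟨j, rfl⟩)
  rw [← mu_add_rank σ f p k i]
  congr 1
  -- For this `s` the ideal Δ_{i-e+1+k+s} contracts to the truncation of `p` on the ring containing
  -- the entries of J_{k,i}, so the two ranks agree there. The constant rank hypothesis brings the
  -- equality back to `s = 0`.
  obtain ⟨s, hs⟩ := exists_forall_pTrunc_le hmin hqr (i + 1 - maxOrder f + k + 0 + maxOrder f - 1)
  rw [← hrank k i hi s, rankOverDelta, pseudoJacobianIn_eq_map, Matrix.map_map,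
    ← map_valA_pseudoJacobianIn σ f k i 0, Matrix.map_map]
  have hle : i + 1 - maxOrder f + k + 0 + maxOrder f - 1 ≤
    i + 1 - maxOrder f + k + s + maxOrder f - 1 := by omega
  have hprime := isPrime_DeltaTrunc hf hqr (i + 1 - maxOrder f + k + s)
  let : Field (FracQuot (DeltaTrunc σ f p (i + 1 - maxOrder f + k + s))) := FractionRing.field _
  refine Matrix.rank_map_eq_of_ker_eq (pseudoJacobianIn σ f k i 0)
    ((toFracDelta σ f p (i + 1 - maxOrder f + k + s)).toRingHom.comp (inclA K n hle))
    ((algebraMap (DiffPoly K n) p.ResidueField).comp (valA K n _)) ?_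
  have h1 : RingHom.ker ((algebraMap (DiffPoly K n) p.ResidueField).comp
      (valA K n (i + 1 - maxOrder f + k + 0 + maxOrder f - 1))) = pTrunc p _ := by
    rw [← RingHom.comap_ker, Ideal.ker_algebraMap_residueField]
    rfl
  rw [h1]
  refine le_antisymm (fun g hg => ?_) fun g hg => hs _ (by omega) hle g hg
  have h2 : toFracDelta σ f p (i + 1 - maxOrder f + k + s) (inclA K n hle g) = 0 := hg
  rw [toFracDelta_eq_zero_iff] at h2
  have h3 := DeltaTrunc_le_maximalIdeal hp hf _ h2
  rw [algebraMap_mem_maximalIdeal_iff, pTrunc, Ideal.mem_comap, valA_inclA] at h3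
  exact h3

theorem ker_toFracDelta_le (hp : IsDiffPrime (transform σ) p) (hf : ∀ j, f j ∈ p) (m : ℕ) :
    RingHom.ker (toFracDelta σ f p m) ≤ pTrunc p (m + maxOrder f - 1) := by
  intro g hg
  have h1 : toFracDelta σ f p m g = 0 := hg
  rw [toFracDelta_eq_zero_iff] at h1
  exact algebraMap_mem_maximalIdeal_iff.1 (DeltaTrunc_le_maximalIdeal hp hf _ h1)

theorem linearIndependent_grad_transformIn (hqr : IsQuasiRegular σ f p hp)
    (m : ℕ) {L : Type*} [Field L] [Algebra K L] (φ : A K n (m + maxOrder f - 1) →ₐ[K] L)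
    (hφ : RingHom.ker φ ≤ pTrunc p (m + maxOrder f - 1)) :
    LinearIndependent L fun x : Fin m × Fin r => grad φ (transformIn σ f m x.1 x.2) := by
  refine Matrix.linearIndependent_map_of_ker_le
    (fun (x : Fin m × Fin r) v => pderiv v (transformIn σ f m x.1 x.2)) φ.toRingHom
    ((residue (B p (m + maxOrder f - 1))).comp (algebraMap _ _)) (fun a ha => ?_)
    (linearIndependent_residue_pderiv hqr m)
  exact (residue_algebraMap_eq_zero_iff (pTrunc p _)).2 (hφ ha)

/-- A polynomial vanishing at the generic point of Δ_m is a combination of the f_j^{(l)} up to a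
denominator outside `p`. Such a denominator does not vanish at this point because Δ_m lies in the
maximal ideal. -/
theorem conormal_toFracDelta (hp : IsDiffPrime (transform σ) p) (hf : ∀ j, f j ∈ p) (m : ℕ)
    {L : Type*} [Field L] [Algebra K L] (φ : A K n (m + maxOrder f - 1) →ₐ[K] L)
    (hφ : ∀ a, φ a = 0 ↔ algebraMap _ (B p _) a ∈ DeltaTrunc σ f p m) :
    conormal φ = Submodule.span L
      (Set.range fun x : Fin m × Fin r => grad φ (transformIn σ f m x.1 x.2)) := by
  have h0 : ∀ x : Fin m × Fin r, φ (transformIn σ f m x.1 x.2) = 0 := fun x =>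
    (hφ _).2 (Ideal.subset_span ⟨x, rfl⟩)
  apply le_antisymm
  · rw [conormal, Submodule.span_le]
    rintro _ ⟨g, hg, rfl⟩
    have h1 : algebraMap _ (B p (m + maxOrder f - 1)) g ∈
        (Ideal.span (Set.range fun x : Fin m × Fin r => transformIn σ f m x.1 x.2)).map
          (algebraMap _ (B p (m + maxOrder f - 1))) := by
      rw [Ideal.map_span, ← Set.range_comp]
      exact (hφ g).1 hg
    obtain ⟨s, hs, hsg⟩ := (IsLocalization.algebraMap_mem_map_algebraMap_iff
      (pTrunc p (m + maxOrder f - 1)).primeCompl _ _ _).1 h1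
    refine grad_mem_span_of_mul_mem φ h0 (s := s) (fun hs0 => hs ?_) hg hsg
    exact algebraMap_mem_maximalIdeal_iff.1
      (DeltaTrunc_le_maximalIdeal hp hf m ((hφ s).1 hs0))
  · rw [Submodule.span_le]
    rintro _ ⟨x, rfl⟩
    exact Submodule.subset_span ⟨_, h0 x, rfl⟩

/-- The inclusion of the variables of `A_N` in those of `A_{N'}`. -/
def inclVar (n : ℕ) {N N' : ℕ} (h : N ≤ N') (v : {v : Fin n × ℕ // v.2 ≤ N}) :
    {v : Fin n × ℕ // v.2 ≤ N'} := ⟨v.1, v.2.trans h⟩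

theorem inclVar_injective {N N' : ℕ} (h : N ≤ N') : Function.Injective (inclVar n h) :=
  fun _ _ h => Subtype.ext (congrArg Subtype.val h :)

theorem notMem_range_inclVar {N N' : ℕ} (h : N ≤ N') (v : {v : Fin n × ℕ // v.2 ≤ N'}) :
    v ∉ Set.range (inclVar n h) ↔ N < v.1.2 := by
  rw [← not_le, not_iff_not]
  constructor
  · rintro ⟨w, rfl⟩
    exact w.2
  · exact fun hv => ⟨⟨v.1, hv⟩, rfl⟩

/-- The Jacobian matrix of the `f_j^{(l)}`, `l < i-e+1+k`, with respect to the variables of order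
greater than `i` has the rank of `J_{k,i}`. -/
theorem rank_jacobian_eq (k : ℕ) {i : ℕ} (hi : maxOrder f ≤ i + 1) {L : Type*} [Field L]
    [Algebra K L] (φ : A K n (i + 1 - maxOrder f + k + maxOrder f - 1) →ₐ[K] L)
    (h : i ≤ i + 1 - maxOrder f + k + maxOrder f - 1) [Fintype {v // v ∉ Set.range (inclVar n h)}] :
    (Matrix.of fun (x : Fin (i + 1 - maxOrder f + k) × Fin r)
      (v : {v // v ∉ Set.range (inclVar n h)}) =>
        grad φ (transformIn σ f (i + 1 - maxOrder f + k) x.1 x.2) v).rank =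
    ((pseudoJacobianIn σ f k i 0).map φ).rank := by
  set N := i + 1 - maxOrder f + k + maxOrder f - 1 with hN
  let ρ : Fin k × Fin r → Fin (i + 1 - maxOrder f + k) × Fin r := fun x =>
    (⟨i + 1 - maxOrder f + x.1, by have := x.1.2; omega⟩, x.2)
  let ε : Fin k × Fin n → {v // v ∉ Set.range (inclVar n h)} := fun y =>
    ⟨⟨(y.2, i + 1 + y.1), by have := y.1.2; simp only; omega⟩, by
      rw [notMem_range_inclVar]; simp only; omega⟩
  have hvars : ∀ x : Fin (i + 1 - maxOrder f + k) × Fin r,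
      ∀ v ∈ ((transform σ)^[x.1] (f x.2)).vars, v.2 ≤ N := fun x v hv =>
    (order_iterate_transform_le σ f x.2 x.1 v hv).trans (by have := x.1.2; omega)
  -- The omitted rows have l < i - e + 1, hence order at most `i`, and vanish in all the columns
  -- considered.
  rw [← Matrix.rank_submatrix_of_cover _ ρ ε ?_ ?_]
  · congr 1
    ext x y
    simp only [Matrix.submatrix_apply, Matrix.of_apply, grad, transformIn, Matrix.map_apply]
    rw [pderiv_toA (hvars (ρ x))]
    rfl
  · intro x hx v
    simp only [Matrix.of_apply, grad, transformIn]
    have hv := (notMem_range_inclVar h v.1).1 v.2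
    have hlt : (x.1 : ℕ) < i + 1 - maxOrder f := by
      by_contra hge
      refine hx ⟨(⟨x.1 - (i + 1 - maxOrder f), by have := x.1.2; omega⟩, x.2), ?_⟩
      refine Prod.ext (Fin.ext ?_) rfl
      simp only [ρ]
      omega
    rw [pderiv_toA (hvars x), pderiv_iterate_transform_eq_zero σ f
      (show maxOrder f + (x.1 : ℕ) < v.1.1.2 by omega), map_zero, map_zero]
  · intro v
    have hv := (notMem_range_inclVar h v.1).1 v.2
    have hv2 := v.1.2
    refine ⟨(⟨v.1.1.2 - (i + 1), by omega⟩, v.1.1.1), ?_⟩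
    refine Subtype.ext (Subtype.ext (Prod.ext rfl ?_))
    simp only [ε]
    omega

/-- The height of `Δ_{i-e+1+k} ∩ A_i`. -/
theorem height_DeltaTruncPoly [CharZero K]
    (hmin : IsMinimalDiffPrimeOver (transform σ) (Set.range f) p)
    (hqr : IsQuasiRegular σ f p hp) (hrank : HasConstantRanks σ f p) (k : ℕ) {i : ℕ}
    (hi : maxOrder f ≤ i + 1) :
    (DeltaTruncPoly σ f p i k).height =
      ((i + 1 - maxOrder f) * r + mu σ f p k i : ℕ) := by
  classical
  have hf : ∀ j, f j ∈ p := fun j => hmin.prop.2 (subset_diffSpan _ _ ⟨j, rfl⟩)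
  have h : i ≤ i + 1 - maxOrder f + k + maxOrder f - 1 := by omega
  have hprime := isPrime_DeltaTrunc hf hqr (i + 1 - maxOrder f + k)
  let : Field (FracQuot (DeltaTrunc σ f p (i + 1 - maxOrder f + k))) := FractionRing.field _
  have : CharZero (FracQuot (DeltaTrunc σ f p (i + 1 - maxOrder f + k))) :=
    charZero_of_injective_algebraMap
      (algebraMap K (FracQuot (DeltaTrunc σ f p (i + 1 - maxOrder f + k)))).injective
  let φ := toFracDelta σ f p (i + 1 - maxOrder f + k)
  have := Fintype.ofFinite {v // v ∉ Set.range (inclVar n h)}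
  have h1 := finrank_conormal_rename_add_rank (inclVar_injective h) φ _
    (conormal_toFracDelta hp hf _ φ (toFracDelta_eq_zero_iff _))
    (linearIndependent_grad_transformIn hqr _ φ (ker_toFracDelta_le hp hf _))
  rw [rank_jacobian_eq k hi φ h] at h1
  have h2 : DeltaTruncPoly σ f p i k = RingHom.ker (φ.comp (rename (inclVar n h))) := by
    ext g
    exact mem_DeltaTruncPoly g
  rw [h2, height_ker_eq_finrank_conormal]
  have h3 := mu_add_rankOverDelta hmin hqr hrank k (i := i) (by omega)
  have h4 : rankOverDelta σ f p k i 0 = ((pseudoJacobianIn σ f k i 0).map φ).rank := rfl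
  rw [h4] at h3
  rw [Fintype.card_prod, Fintype.card_fin, Fintype.card_fin, add_mul] at h1
  norm_cast
  omega

/-- An ideal of the localization B_i is generated by its contraction to A_i, and Δ contracts to p ∩
A_i. -/
theorem DeltaTruncInter_eq_iff (hmin : IsMinimalDiffPrimeOver (transform σ) (Set.range f) p)
    (hqr : IsQuasiRegular σ f p hp) (i h : ℕ) :
    DeltaTruncInter σ f p i h = DeltaInter σ f p hp i ↔
      DeltaTruncPoly σ f p i h = pTrunc p i := by
  have h1 : (DeltaInter σ f p hp i).comap (algebraMap _ (B p i)) = pTrunc p i := by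
    ext g
    rw [Ideal.mem_comap, DeltaInter, Ideal.mem_comap, inclLoc_algebraMap,
      algebraMap_mem_Delta_iff hmin hqr]
    rfl
  refine ⟨fun h => by rw [DeltaTruncPoly, h, h1], fun h => ?_⟩
  have h2 := congrArg (Ideal.map (algebraMap (A K n i) (B p i))) (h.trans h1.symm)
  rwa [DeltaTruncPoly, IsLocalization.map_under (pTrunc p i).primeCompl,
    IsLocalization.map_under (pTrunc p i).primeCompl] at h2

/-- Both ideals are prime and the first lies in the second, so they agree exactly when their heights
do. The heights differ by μ_{ω,i} - μ_{h,i}, which is zero precisely from `ω` on. -/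
theorem DeltaTruncPoly_eq_pTrunc_iff [CharZero K]
    (hmin : IsMinimalDiffPrimeOver (transform σ) (Set.range f) p)
    (hqr : IsQuasiRegular σ f p hp) (hrank : HasConstantRanks σ f p) {ω : ℕ}
    (hω : IsDifferenceIndex σ f p ω) {i : ℕ} (hi : maxOrder f ≤ i + 1) (h : ℕ) :
    DeltaTruncPoly σ f p i h = pTrunc p i ↔ ω ≤ h := by
  have hf : ∀ j, f j ∈ p := fun j => hmin.prop.2 (subset_diffSpan _ _ ⟨j, rfl⟩)
  obtain ⟨h1, h2⟩ := hω i (by omega)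
  have hmono : Monotone fun k => mu σ f p k i :=
    monotone_nat_of_le_succ fun k => mu_le_succ σ f p k hi
  have hconst : ∀ k, ω ≤ k → mu σ f p k i = mu σ f p ω i := by
    intro k hk
    induction k, hk using Nat.le_induction with
    | base => rfl
    | succ k hk ih => rw [← h2 k hk, ih]
  obtain ⟨h₀, hh₀⟩ := exists_forall_DeltaTruncPoly_eq hmin hqr i
  have hp' : (pTrunc p i).height = ((i + 1 - maxOrder f) * r + mu σ f p ω i : ℕ) := by
    -- At this index the contraction is already p ∩ A_i and μ has reached its final value.
    rw [← hh₀ (max h₀ ω) (le_max_left _ _), height_DeltaTruncPoly hmin hqr hrank _ hi,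
      hconst _ (le_max_right _ _)]
  constructor
  · intro heq
    by_contra hlt
    rw [← heq, height_DeltaTruncPoly hmin hqr hrank _ hi] at hp'
    have h3 : (i + 1 - maxOrder f) * r + mu σ f p h i =
        (i + 1 - maxOrder f) * r + mu σ f p ω i := by exact_mod_cast hp'
    have h4 := h1 h (not_le.1 hlt)
    have h5 := hmono (show h + 1 ≤ ω by omega)
    simp only at h5
    omega
  · intro hle
    have hprime := isPrime_DeltaTruncPoly hf hqr i h
    by_contra hne
    have hlt := lt_of_le_of_ne (DeltaTruncPoly_le_pTrunc hp hf i h) hne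
    have h3 := Ideal.height_strict_mono_of_isPrime_of_isPrime hlt
    rw [hp', height_DeltaTruncPoly hmin hqr hrank _ hi, hconst h hle] at h3
    exact lt_irrefl _ h3

end DifferenceAlgebra

end

/-! ### The theorem. -/

open DifferenceAlgebra
theorem mainTheorem1 {K : Type*} [Field K] [CharZero K] (σ : K →+* K) {n r : ℕ}
    (f : Fin r → DiffPoly K n) (he : 1 ≤ maxOrder f)
    (p : Ideal (DiffPoly K n)) [p.IsPrime] (hp : IsDiffPrime (transform σ) p)
    (hmin : IsMinimalDiffPrimeOver (transform σ) (Set.range f) p)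
    (hqr : IsQuasiRegular σ f p hp)
    (hrank : HasConstantRanks σ f p) :
    (∃! ω : ℕ, IsDifferenceIndex σ f p ω) ∧
    ∀ ω : ℕ, IsDifferenceIndex σ f p ω → ∀ i : ℕ, maxOrder f - 1 ≤ i →
      DeltaTruncInter σ f p i ω = DeltaInter σ f p hp i ∧
      IsLeast {h : ℕ | DeltaTruncInter σ f p i h = DeltaInter σ f p hp i} ω := by
  have hf : ∀ j, f j ∈ p := fun j => hmin.prop.2 (subset_diffSpan _ _ ⟨j, rfl⟩)
  constructor
  -- For i = e - 1 the height formula reads ht P_k = μ_{k,e-1}, so the height of p ∩ A_{e-1} bounds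
  -- the sequence.
  · obtain ⟨N, hN⟩ := ENat.ne_top_iff_exists.1
      (Ideal.height_ne_top (I := pTrunc p (maxOrder f - 1)) Ideal.IsPrime.ne_top')
    refine exists_isDifferenceIndex σ f p hp rfl (N := N) fun k => ?_
    have h1 := Ideal.height_mono (DeltaTruncPoly_le_pTrunc hp hf (maxOrder f - 1) k)
    rw [height_DeltaTruncPoly hmin hqr hrank k (by omega), ← hN] at h1
    have h2 : (maxOrder f - 1 + 1 - maxOrder f) * r + mu σ f p k (maxOrder f - 1) ≤ N := by
      exact_mod_cast h1
    omega
  · intro ω hω i hi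
    have key : ∀ h, DeltaTruncInter σ f p i h = DeltaInter σ f p hp i ↔ ω ≤ h := fun h =>
      (DeltaTruncInter_eq_iff hmin hqr i h).trans
        (DeltaTruncPoly_eq_pTrunc_iff hmin hqr hrank hω (by omega) h)
    exact ⟨(key ω).2 le_rfl, (key ω).2 le_rfl, fun h hh => (key h).1 hh⟩
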